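/- Let $m_1>m_2\ge 2$ and $q\ge 2$ be integers, $\gamma=\log m_2/\log m_1$, and let $j\ge 0$ be the unique integer with $q^j\le 1/\gamma<q^{j+1}$, i.e. $j=\lfloor\log_q(\log m_1/\log m_2)\rfloor$. Let $\Sigma=(\{0,\dots,m_1-1\}\times\{0,\dots,m_2-1\})^{\{1,2,3,\dots\}}$, with the product topology and with the metric $$d\big((x_k,y_k)_k,(u_k,v_k)_k\big)=\max\Big(m_1^{-\min\{k\ge 0\,:\,(x_{k+1},y_{k+1})\ne(u_{k+1},v_{k+1})\}},\ m_1^{-\gamma\min\{k\ge 0\,:\,y_{k+1}\ne v_{k+1}\}}\Big)$$ (where $m_1^{-\infty}=0$). For a closed set $\Omega\subset\Sigma$ let $$X_\Omega=\{(x_k,y_k)_{k\ge1}\in\Sigma:\ (x_{iq^\ell},y_{iq^\ell})_{\ell=0}^\infty\in\Omega\ \text{ for all } i\ge 1 \text{ with } q\nmid i\}.$$ For a Borel probability measure $\mu$ on $\Omega$ let $\mathbb P_\mu$ be the Borel probability measure on $\Sigma$ determined by $$\mathbb P_\mu\big([z_1\cdots z_n]\big)=\prod_{1\le i\le n,\ q\nmid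 i}\mu\big(\Omega\cap[z_i\,z_{qi}\cdots z_{q^{r}i}]\big),\qquad q^{r}i\le n<q^{r+1}i \quad (r=r(i,n)),$$ where $[w]$ is the set of sequences that begin with the word $w$. Let $\alpha^1_k$ (respectively $\alpha^2_k$) be the finite partition of $\Omega$ according to the word $y_1\cdots y_k$ (respectively $(x_1,y_1)\cdots(x_k,y_k)$), with $\alpha^2_0=\{\Omega\}$, let $\lor$ denote the join of partitions, and let $H^\mu_{m_2}(\mathcal P)=-\sum_{C\in\mathcal P}\mu(C)\log_{m_2}\mu(C)$. Then $\mathbb P_\mu(X_\Omega)=1$, the two series below converge, and, with $$\begin{aligned}\delta={}&(q-1)^2\sum_{p=1}^{j}\frac{H^\mu_{m_2}(\alpha^1_p)}{q^{p+1}}+(q-1)(q^{j+1}\gamma-1)\sum_{p=j+1}^\infty\frac{H^\mu_{m_2}(\alpha^2_{p-j}\lor\alpha^1_p)}{q^{p+1}}\\&+(q-1)(1-q^j\gamma)\sum_{p=j+1}^\infty\frac{H^\mu_{m_2}(\alpha^2_{p-j-1}\lor\alpha^1_p)}{q^{p}},\end{aligned}$$ the measure $\mathbb P_\mu$ is exact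 dimensional for $d$ with dimension $\delta$: for $\mathbb P_\mu$-almost every $z\in\Sigma$, $$\lim_{r\to0^+}\frac{\log\mathbb P_\mu(B_d(z,r))}{\log r}=\delta .$$ Moreover $\dim_H(\mathbb P_\mu)=\delta$, both for the lower Hausdorff dimension (the infimum of $\dim_H A$ over Borel sets $A$ with $\mathbb P_\mu(A)>0$) and for the upper one (the infimum over Borel sets $A$ with $\mathbb P_\mu(A)=1$), Hausdorff dimension being taken for $d$. -/

import Mathlib

open MeasureTheory Filter Topology

namespace MultCarpet

noncomputable section

/-! ### Symbolic space and the quasi-square metric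

Sequences are indexed from `0`: the entry `z k` is the `(k+1)`-st letter `(x_{k+1}, y_{k+1})`. -/

/-- The symbolic space of sequences over `{0,…,m₁-1} × {0,…,m₂-1}`, with the product topology and
the product (equivalently Borel) σ-algebra. -/
abbrev Sym (m₁ m₂ : ℕ) : Type := ℕ → Fin m₁ × Fin m₂

/-- Projection on the second coordinate. -/
def snds {m₁ m₂ : ℕ} (z : Sym m₁ m₂) : ℕ → Fin m₂ := fun k => (z k).2

/-- The exponent `γ = log m₂ / log m₁`. -/
def gam (m₁ m₂ : ℕ) : ℝ := Real.log m₂ / Real.log m₁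

/-- `b ^ (-min {k ≥ 0 : s k ≠ t k})`, which is `0` when the sequences agree. -/
def seqDist {α : Type} (b : ℝ) (s t : ℕ → α) : ℝ :=
  open scoped Classical in if s = t then 0 else (b ^ PiNat.firstDiff s t)⁻¹

/-- The quasi-square distance
`max (m₁ ^ (-min {k : (x_{k+1},y_{k+1}) ≠ (u_{k+1},v_{k+1})}))
  (m₁ ^ (-γ * min {k : y_{k+1} ≠ v_{k+1}}))`. -/
def qsDist (m₁ m₂ : ℕ) (z w : Sym m₁ m₂) : ℝ :=
  max (seqDist (m₁ : ℝ) z w) (seqDist ((m₁ : ℝ) ^ gam m₁ m₂) (snds z) (snds w))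

section metric

variable {α : Type} {b : ℝ}

theorem seqDist_self (s : ℕ → α) : seqDist b s s = 0 := by simp [seqDist]

theorem seqDist_comm (s t : ℕ → α) : seqDist b s t = seqDist b t s := by
  unfold seqDist
  rw [PiNat.firstDiff_comm s t]
  by_cases h : s = t
  · simp [h]
  · rw [if_neg h, if_neg (Ne.symm h)]

theorem seqDist_nonneg (hb : 1 < b) (s t : ℕ → α) : 0 ≤ seqDist b s t := by
  unfold seqDist; split_ifs <;> positivity

theorem seqDist_pos (hb : 1 < b) {s t : ℕ → α} (h : s ≠ t) : 0 < seqDist b s t := by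
  rw [seqDist, if_neg h]; positivity

theorem seqDist_le_iff (hb : 1 < b) {s t : ℕ → α} {n : ℕ} :
    seqDist b s t ≤ (b ^ n)⁻¹ ↔ ∀ k < n, s k = t k := by
  have hb0 : 0 < b := by linarith
  unfold seqDist
  split_ifs with h
  · subst h; simp; positivity
  · rw [inv_le_inv₀ (by positivity) (by positivity), pow_le_pow_iff_right₀ hb,
      ← PiNat.mem_cylinder_iff_le_firstDiff h, PiNat.mem_cylinder_iff]

theorem seqDist_ultra (hb : 1 < b) (s t u : ℕ → α) :
    seqDist b s u ≤ max (seqDist b s t) (seqDist b t u) := by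
  by_cases hsu : s = u
  · subst hsu; rw [seqDist_self]; exact le_max_of_le_left (seqDist_nonneg hb _ _)
  by_cases hst : s = t
  · subst hst; exact le_max_right _ _
  by_cases htu : t = u
  · subst htu; exact le_max_left _ _
  have hb0 : 0 < b := by linarith
  rw [seqDist, seqDist, seqDist, if_neg hsu, if_neg hst, if_neg htu]
  have h := PiNat.min_firstDiff_le s t u hsu
  rcases min_le_iff.1 h with h | h
  · exact le_max_of_le_left (inv_anti₀ (by positivity) (pow_le_pow_right₀ hb.le h))
  · exact le_max_of_le_right (inv_anti₀ (by positivity) (pow_le_pow_right₀ hb.le h))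

variable {m₁ m₂ : ℕ}

theorem one_lt_rpow_gam (h₁ : 2 ≤ m₁) (h₂ : 2 ≤ m₂) : 1 < (m₁ : ℝ) ^ gam m₁ m₂ := by
  have h1 : (1 : ℝ) < m₁ := by exact_mod_cast h₁
  have h2 : (1 : ℝ) < m₂ := by exact_mod_cast h₂
  exact Real.one_lt_rpow h1 (div_pos (Real.log_pos h2) (Real.log_pos h1))

theorem qsDist_isOpen_iff (h₁ : 2 ≤ m₁) (h₂ : 2 ≤ m₂) (s : Set (Sym m₁ m₂)) :
    IsOpen s ↔ ∀ z ∈ s, ∃ ε > 0, ∀ w, qsDist m₁ m₂ z w < ε → w ∈ s := by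
  have hb : (1 : ℝ) < m₁ := by exact_mod_cast h₁
  have hc := one_lt_rpow_gam h₁ h₂
  constructor
  · intro hs z hz
    obtain ⟨v, ⟨y, n, rfl⟩, hzv, hvs⟩ :=
      (PiNat.isTopologicalBasis_cylinders fun _ : ℕ => Fin m₁ × Fin m₂).exists_subset_of_mem_open
        hz hs
    rw [← PiNat.mem_cylinder_iff_eq.1 hzv] at hvs
    refine ⟨((m₁ : ℝ) ^ n)⁻¹, by positivity, fun w hw => hvs fun i hi => ?_⟩
    exact ((seqDist_le_iff hb).1 ((le_max_left _ _).trans hw.le) i hi).symm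
  · intro h
    refine (PiNat.isTopologicalBasis_cylinders fun _ : ℕ => Fin m₁ × Fin m₂).isOpen_iff.2
      fun z hz => ?_
    obtain ⟨ε, hε, H⟩ := h z hz
    obtain ⟨n, hn⟩ := exists_pow_lt_of_lt_one hε (inv_lt_one_of_one_lt₀ hb)
    obtain ⟨k, hk⟩ := exists_pow_lt_of_lt_one hε (inv_lt_one_of_one_lt₀ hc)
    refine ⟨_, ⟨z, max n k, rfl⟩, PiNat.self_mem_cylinder z _, fun w hw => H w (max_lt ?_ ?_)⟩
    · refine lt_of_le_of_lt ((seqDist_le_iff hb).2 fun i hi => ?_) (by simpa using hn)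
      exact (hw i (lt_max_of_lt_left hi)).symm
    · refine lt_of_le_of_lt ((seqDist_le_iff hc).2 fun i hi => ?_) (by simpa using hk)
      simp only [snds, hw i (lt_max_of_lt_right hi)]

/-- The quasi-square metric; it induces the product topology. -/
@[reducible]
def qsMetric (h₁ : 2 ≤ m₁) (h₂ : 2 ≤ m₂) : MetricSpace (Sym m₁ m₂) :=
  have hb : (1 : ℝ) < m₁ := by exact_mod_cast h₁
  have hc := one_lt_rpow_gam h₁ h₂
  MetricSpace.ofDistTopology (qsDist m₁ m₂)
    (fun z => by simp [qsDist, seqDist_self])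
    (fun z w => by simp only [qsDist, seqDist_comm z w, seqDist_comm (snds z)])
    (fun z w v => by
      have e₁ := seqDist_ultra hb z w v
      have e₂ := seqDist_ultra hc (snds z) (snds w) (snds v)
      have p₁ := seqDist_nonneg hb z w
      have p₂ := seqDist_nonneg hb w v
      refine (?_ : _ ≤ max (qsDist m₁ m₂ z w) (qsDist m₁ m₂ w v)).trans
        (max_le_add_of_nonneg (le_max_of_le_left p₁) (le_max_of_le_left p₂))
      refine max_le (e₁.trans (max_le_max (le_max_left _ _) (le_max_left _ _)))
        (e₂.trans (max_le_max (le_max_right _ _) (le_max_right _ _))))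
    (qsDist_isOpen_iff h₁ h₂)
    (fun z w h => by
      by_contra hne
      exact absurd ((le_max_left _ _).trans h.le) (not_le.2 (seqDist_pos hb hne)))

end metric

/-! ### Dimensions of measures -/

section dimension

variable {X : Type} [MetricSpace X] [MeasurableSpace X]

/-- `ν` is exact dimensional with dimension `δ`: at `ν`-almost every point the local dimension
`lim_{r → 0} log ν(B(z,r)) / log r` exists and equals `δ`. -/
def HasExactDim (ν : Measure X) (δ : ℝ) : Prop :=
  ∀ᵐ z ∂ν, Tendsto (fun r : ℝ => Real.log (ν.real (Metric.closedBall z r)) / Real.log r)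
    (𝓝[>] 0) (𝓝 δ)

/-- Lower Hausdorff dimension of `ν`: the infimum of `dim_H A` over Borel sets of positive
measure. -/
def lowerDimH (ν : Measure X) : ENNReal :=
  ⨅ (A : Set X) (_ : MeasurableSet A) (_ : ν A ≠ 0), dimH A

/-- Upper Hausdorff dimension of `ν`: the infimum of `dim_H A` over Borel sets of full
measure. -/
def upperDimH (ν : Measure X) : ENNReal :=
  ⨅ (A : Set X) (_ : MeasurableSet A) (_ : ν Aᶜ = 0), dimH A

end dimension

/-! ### The set `X_Ω` and the measure `ℙ_μ` -/

variable {m₁ m₂ : ℕ}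

/-- The subsequence `(z_{i q^ℓ})_{ℓ ≥ 0}` along the geometric progression of `i ≥ 1`
(letters numbered from `1`). -/
def along (q i : ℕ) (z : Sym m₁ m₂) : Sym m₁ m₂ := fun l => z (i * q ^ l - 1)

/-- The set `X_Ω` of sequences whose subsequence along `(i q^ℓ)_ℓ` is in `Ω` for all `i` not
divisible by `q`. -/
def XSet (q : ℕ) (Ω : Set (Sym m₁ m₂)) : Set (Sym m₁ m₂) :=
  {z | ∀ i : ℕ, ¬ q ∣ i → along q i z ∈ Ω}

/-- The sequence whose subsequence along `(i q^ℓ)_ℓ` is `ω i`, for each `i` not divisible by `q`: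
its letter number `i q^ℓ` is letter number `ℓ + 1` of `ω i`. -/
def assemble (q : ℕ) (ω : ℕ → Sym m₁ m₂) : Sym m₁ m₂ :=
  fun k => ω ((k + 1) / q ^ multiplicity q (k + 1)) (multiplicity q (k + 1))

/-- The measure `ℙ_μ` on the whole symbolic space: the subsequences along `(i q^ℓ)_ℓ`, `q ∤ i`, are
independent with law `μ`. By `PMeas_cylinder` and `eq_PMeas_of_cylinder` below, it is the unique
measure with `ℙ_μ [z|_n] = ∏_{i ≤ n, q ∤ i} μ [z|_{J_i^n}]` for all `z` and `n`. -/
def PMeas (q : ℕ) {Ω : Set (Sym m₁ m₂)} (μ : Measure Ω) : Measure (Sym m₁ m₂) :=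
  (Measure.infinitePi fun _ : ℕ => μ.map Subtype.val).map (assemble q)

section PMeas

theorem measurable_assemble (q : ℕ) : Measurable (assemble (m₁ := m₁) (m₂ := m₂) q) := by
  unfold assemble; fun_prop

theorem assemble_mul_pow {q i : ℕ} (hq : 2 ≤ q) (hi : ¬ q ∣ i) (l : ℕ) (ω : ℕ → Sym m₁ m₂) :
    assemble q ω (i * q ^ l - 1) = ω i l := by
  have hi0 : 0 < i := Nat.pos_of_ne_zero (by rintro rfl; simp at hi)
  have hq0 : 0 < q := by omega
  have hp : 0 < i * q ^ l := by positivity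
  have hm : multiplicity q (i * q ^ l) = l := by
    refine multiplicity_eq_of_dvd_of_not_dvd (Dvd.intro_left _ rfl) ?_
    rw [pow_succ']
    exact fun h => hi (Nat.dvd_of_mul_dvd_mul_right (by positivity) h)
  unfold assemble
  rw [Nat.sub_add_cancel hp, hm, Nat.mul_div_cancel _ (by positivity)]

theorem exists_eq_mul_pow {q : ℕ} (hq : 2 ≤ q) (k : ℕ) :
    ∃ i l : ℕ, ¬ q ∣ i ∧ i * q ^ l = k + 1 := by
  obtain ⟨l, i, hi, h⟩ := Nat.exists_eq_pow_mul_and_not_dvd (Nat.succ_ne_zero k) q (by omega)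
  exact ⟨i, l, hi, by rw [mul_comm]; exact h.symm⟩

theorem assemble_mem_cylinder_iff {q : ℕ} (hq : 2 ≤ q) (ω : ℕ → Sym m₁ m₂) (z : Sym m₁ m₂)
    (n : ℕ) : assemble q ω ∈ PiNat.cylinder z n ↔
      ∀ i ∈ (Finset.Icc 1 n).filter (fun i => ¬ q ∣ i),
        ω i ∈ PiNat.cylinder (along q i z) (Nat.log q (n / i) + 1) := by
  have hq0 : 0 < q := by omega
  constructor
  · intro h i hi l hl
    simp only [Finset.mem_filter, Finset.mem_Icc] at hi
    obtain ⟨⟨hi1, hin⟩, hqi⟩ := hi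
    have hle : q ^ l ≤ n / i := Nat.pow_le_of_le_log (Nat.div_pos hin hi1).ne' (by omega)
    have hle' : i * q ^ l ≤ n := by
      rw [mul_comm]; exact (Nat.le_div_iff_mul_le hi1).1 hle
    have hp : 0 < i * q ^ l := by positivity
    rw [← assemble_mul_pow hq hqi l ω]
    exact h _ (by omega)
  · intro h k hk
    obtain ⟨i, l, hqi, hil⟩ := exists_eq_mul_pow hq k
    have hi0 : 0 < i := Nat.pos_of_ne_zero (by rintro rfl; simp at hqi)
    have hk' : k = i * q ^ l - 1 := by omega
    have hin : i * q ^ l ≤ n := by omega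
    have hle : q ^ l ≤ n / i := (Nat.le_div_iff_mul_le hi0).2 (by rwa [mul_comm])
    have hin' : i ≤ n := (Nat.le_mul_of_pos_right i (by positivity)).trans hin
    have := h i (by simp [hqi]; omega) l
      (Nat.lt_succ_of_le (Nat.le_log_of_pow_le (by omega) hle))
    rw [hk', assemble_mul_pow hq hqi l ω, this]
    rfl

theorem measurableSet_cylinder (z : Sym m₁ m₂) (n : ℕ) : MeasurableSet (PiNat.cylinder z n) := by
  rw [PiNat.cylinder_eq_pi]
  exact MeasurableSet.pi (Finset.range n).countable_toSet fun _ _ => measurableSet_singleton _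

instance (q : ℕ) {Ω : Set (Sym m₁ m₂)} (μ : Measure Ω) [IsProbabilityMeasure μ] :
    IsProbabilityMeasure (PMeas q μ) := by
  have : IsProbabilityMeasure (μ.map Subtype.val) :=
    Measure.isProbabilityMeasure_map measurable_subtype_coe.aemeasurable
  exact Measure.isProbabilityMeasure_map (measurable_assemble q).aemeasurable

/-- The defining formula of `ℙ_μ` on cylinders. For `q ∤ i`, the word of the letters of `z` of
indices `i, q i, …, q ^ r i`, where `q ^ r i ≤ n < q ^ (r + 1) i`, has length
`r + 1 = Nat.log q (n / i) + 1`. -/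
theorem PMeas_cylinder {q : ℕ} (hq : 2 ≤ q) {Ω : Set (Sym m₁ m₂)} (μ : Measure Ω)
    [IsProbabilityMeasure μ] (z : Sym m₁ m₂) (n : ℕ) :
    PMeas q μ (PiNat.cylinder z n) = ∏ i ∈ (Finset.Icc 1 n).filter (fun i => ¬ q ∣ i),
      μ (Subtype.val ⁻¹' PiNat.cylinder (along q i z) (Nat.log q (n / i) + 1)) := by
  have : IsProbabilityMeasure (μ.map Subtype.val) :=
    Measure.isProbabilityMeasure_map measurable_subtype_coe.aemeasurable
  rw [PMeas, Measure.map_apply (measurable_assemble q) (measurableSet_cylinder z n)]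
  have : assemble q ⁻¹' PiNat.cylinder z n =
      Set.pi ((Finset.Icc 1 n).filter (fun i => ¬ q ∣ i) : Finset ℕ)
        (fun i => PiNat.cylinder (along q i z) (Nat.log q (n / i) + 1)) := by
    ext ω
    exact assemble_mem_cylinder_iff hq ω z n
  rw [this, Measure.infinitePi_pi _ (fun _ _ => measurableSet_cylinder _ _)]
  exact Finset.prod_congr rfl fun i _ =>
    Measure.map_apply measurable_subtype_coe (measurableSet_cylinder _ _)

/-- The values on cylinders determine `ℙ_μ`. -/
theorem eq_PMeas_of_cylinder {q : ℕ} (hq : 2 ≤ q) {Ω : Set (Sym m₁ m₂)} (μ : Measure Ω)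
    [IsProbabilityMeasure μ] (ν : Measure (Sym m₁ m₂))
    (h : ∀ z n, ν (PiNat.cylinder z n) = ∏ i ∈ (Finset.Icc 1 n).filter (fun i => ¬ q ∣ i),
      μ (Subtype.val ⁻¹' PiNat.cylinder (along q i z) (Nat.log q (n / i) + 1))) :
    ν = PMeas q μ := by
  have hν : ∀ z n, ν (PiNat.cylinder z n) = PMeas q μ (PiNat.cylinder z n) := fun z n => by
    rw [h, PMeas_cylinder hq]
  have huniv : PMeas q μ Set.univ = ν Set.univ := by
    rcases isEmpty_or_nonempty (Sym m₁ m₂) with he | ⟨⟨z⟩⟩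
    · simp [Set.univ_eq_empty_iff.2 he]
    · simpa using (hν z 0).symm
  refine (ext_of_generate_finite
    {s : Set (Sym m₁ m₂) | ∃ (x : Sym m₁ m₂) (n : ℕ), s = PiNat.cylinder x n} ?_ ?_ ?_ huniv).symm
  · exact (BorelSpace.measurable_eq (α := Sym m₁ m₂)).trans
      (PiNat.isTopologicalBasis_cylinders fun _ : ℕ => Fin m₁ × Fin m₂).borel_eq_generateFrom
  · rintro _ ⟨x, n, rfl⟩ _ ⟨y, k, rfl⟩ ⟨w, hw₁, hw₂⟩
    rw [← PiNat.mem_cylinder_iff_eq.1 hw₁, ← PiNat.mem_cylinder_iff_eq.1 hw₂]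
    rcases le_total n k with hnk | hnk
    · exact ⟨w, k, Set.inter_eq_right.2 (PiNat.cylinder_anti w hnk)⟩
    · exact ⟨w, n, Set.inter_eq_left.2 (PiNat.cylinder_anti w hnk)⟩
  · rintro _ ⟨x, n, rfl⟩
    exact (hν x n).symm

end PMeas

/-! ### Generalized cylinders, partitions and entropy -/

/-- The generalized cylinder `[u]`, `u = (x_1,y_1) ⋯ (x_p,y_p) y_{p+1} ⋯ y_{p+l}`. -/
def genCyl {p l : ℕ} (u : (Fin p → Fin m₁ × Fin m₂) × (Fin l → Fin m₂)) : Set (Sym m₁ m₂) :=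
  {z | (∀ k : Fin p, z k = u.1 k) ∧ ∀ k : Fin l, (z (p + k)).2 = u.2 k}

/-- The set `Pref_{p,l}(Ω)` of the words `u` such that `[u]` meets `Ω`. -/
def Pref (p l : ℕ) (Ω : Set (Sym m₁ m₂)) : Set ((Fin p → Fin m₁ × Fin m₂) × (Fin l → Fin m₂)) :=
  {u | (Ω ∩ genCyl u).Nonempty}

/-- The partition `α¹_k` of `Ω` according to the first `k` letters of `y`. -/
def alpha1 (Ω : Set (Sym m₁ m₂)) (k : ℕ) : Set (Set Ω) :=
  {C | ∃ u ∈ Pref 0 k Ω, C = Subtype.val ⁻¹' genCyl u}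

/-- The partition `α²_k` of `Ω` according to the first `k` letters of `(x,y)`; `α²_0 = {Ω}`. -/
def alpha2 (Ω : Set (Sym m₁ m₂)) (k : ℕ) : Set (Set Ω) :=
  {C | ∃ u ∈ Pref k 0 Ω, C = Subtype.val ⁻¹' genCyl u}

/-- The join `𝒫 ∨ 𝒬` of two partitions. -/
def joinPart {Y : Type} (P Q : Set (Set Y)) : Set (Set Y) :=
  {C | C.Nonempty ∧ ∃ A ∈ P, ∃ B ∈ Q, C = A ∩ B}

/-- The base-`b` entropy `-∑_{C ∈ 𝒫} μ(C) log_b μ(C)` of a finite partition. -/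
def entropy {Y : Type} [MeasurableSpace Y] (b : ℝ) (μ : Measure Y) (P : Set (Set Y)) : ℝ :=
  -∑ᶠ C ∈ P, μ.real C * Real.logb b (μ.real C)

/-- The summand of index `p = j + 1 + k` of the second series:
`H(α²_{p-j} ∨ α¹_p) / q ^ (p + 1)`, in base `m₂`. -/
def termA (q j : ℕ) {Ω : Set (Sym m₁ m₂)} (μ : Measure Ω) (k : ℕ) : ℝ :=
  entropy (m₂ : ℝ) μ (joinPart (alpha2 Ω (k + 1)) (alpha1 Ω (j + 1 + k))) /
    (q : ℝ) ^ (j + 1 + k + 1)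

/-- The summand of index `p = j + 1 + k` of the third series:
`H(α²_{p-j-1} ∨ α¹_p) / q ^ p`, in base `m₂`. -/
def termB (q j : ℕ) {Ω : Set (Sym m₁ m₂)} (μ : Measure Ω) (k : ℕ) : ℝ :=
  entropy (m₂ : ℝ) μ (joinPart (alpha2 Ω k) (alpha1 Ω (j + 1 + k))) / (q : ℝ) ^ (j + 1 + k)

/-- The value of the dimension: the sum over `1 ≤ p ≤ j` and the two series over `p ≥ j + 1`. -/
def dimValue (q j : ℕ) {Ω : Set (Sym m₁ m₂)} (μ : Measure Ω) : ℝ :=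
  ((q : ℝ) - 1) ^ 2 *
      ∑ p ∈ Finset.Icc 1 j, entropy (m₂ : ℝ) μ (alpha1 Ω p) / (q : ℝ) ^ (p + 1)
    + ((q : ℝ) - 1) * ((q : ℝ) ^ (j + 1) * gam m₁ m₂ - 1) * ∑' k, termA q j μ k
    + ((q : ℝ) - 1) * (1 - (q : ℝ) ^ j * gam m₁ m₂) * ∑' k, termB q j μ k

end

end MultCarpet

open MultCarpet

/-!
Write `γ = log m₂ / log m₁`. A ball of radius `r` for the quasi-square metric is an approximate
square (`approxSq`): it fixes the first `⌈γ t⌉` letters and the first `⌈t⌉` second coordinates, where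
`t = -log r / log m₂` (`closedBall_eq_approxSq`). Since `ℙ_μ` makes the subsequences along the
progressions `(i q ^ l)_l`, `q ∤ i`, independent with law `μ`, the quantity `-log ℙ_μ` of an
approximate square is a sum of independent terms, one for each `i ≤ t` with `q ∤ i`: the information
`-log μ` of a smaller approximate square around the `i`-th subsequence
(`ae_neg_log_PMeas_approxSq`).

*Expectation.* For each `i` the expected information is the entropy `H(a, b)` of the join of `α²_a`
and `α¹_b`, where `a` and `b` count the `l` with `i q ^ l ≤ γ t` and `i q ^ l ≤ t`. As
`q ^ j ≤ 1 / γ < q ^ (j + 1)`, the pair `(a, b)` moves along a fixed path as `t` grows, so that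
`H(a, b)` is a sum of increments, the `l`-th of which enters when `i q ^ l` passes `t` or `γ t`
(`sum_steps`). There are about `(1 - 1 / q) t / q ^ l` admissible `i` with `i q ^ l ≤ t`; hence the
expectation divided by `t` converges to a series of increments (`tendsto_sum_starts`), which
summation by parts turns into `δ log m₂` (`tsum_steps`).

*Fluctuations.* The information of a partition into `n` sets has second moment at most
`4 + 2 (log n) ^ 2` (`sum_mul_log_sq_le`), so the variance of the sum is `O(t)`. Along the squares
`t = k ^ 2` almost sure convergence follows, and monotonicity in `t` extends it to all scales
(`ae_tendsto_div_of_variance_le`). Therefore the local dimension is `δ` almost everywhere.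

*Hausdorff dimension.* In any metric space, exact dimensionality with value `δ` forces both
Hausdorff dimensions of the measure to be `δ`: the mass distribution principle gives the lower bound
(`HasExactDim.lowerDimH_ge`), and counting maximal separated sets gives the upper bound
(`HasExactDim.upperDimH_le`).
-/

namespace MultCarpet

/-! ### Hausdorff dimension of an exact dimensional measure -/

section HausdorffDimension

open scoped NNReal ENNReal

variable {X : Type} [MetricSpace X] [MeasurableSpace X]

theorem lowerDimH_le_upperDimH (ν : Measure X) [IsProbabilityMeasure ν] :
    lowerDimH ν ≤ upperDimH ν :=
  le_iInf fun A => le_iInf fun hA => le_iInf fun h0 =>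
    iInf_le_of_le A (iInf_le_of_le hA (iInf_le_of_le
      (by rw [(prob_compl_eq_zero_iff hA).1 h0]; exact one_ne_zero) le_rfl))

variable [BorelSpace X]

/-- Mass distribution principle, for a set that need not be measurable. -/
theorem measure_le_hausdorffMeasure_of_closedBall_le {ν : Measure X} {A : Set X} {s : ℝ≥0}
    (hs : 0 < s) {r₀ : ℝ≥0} (hr₀ : 0 < r₀)
    (h : ∀ z ∈ A, ∀ r : ℝ≥0, 0 < r → r ≤ r₀ → ν (Metric.closedBall z r) ≤ (r : ℝ≥0∞) ^ (s : ℝ)) :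
    ν A ≤ μH[s] A := by
  have hs' : (0 : ℝ) < s := by exact_mod_cast hs
  have key : ∀ t : Set X, Metric.ediam t ≤ r₀ →
      ν (A ∩ t) ≤ ⨆ _ : t.Nonempty, Metric.ediam t ^ (s : ℝ) := by
    intro t ht
    rcases (A ∩ t).eq_empty_or_nonempty with he | ⟨z, hzA, hzt⟩
    · simp [he]
    have hne : t.Nonempty := ⟨z, hzt⟩
    rw [iSup_pos hne]
    lift Metric.ediam t to ℝ≥0 using (ht.trans_lt ENNReal.coe_lt_top).ne with d hd
    have hdr : d ≤ r₀ := by exact_mod_cast ht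
    have hsub : ∀ r : ℝ≥0, d ≤ r → A ∩ t ⊆ Metric.closedBall z r := by
      intro r hr w hw
      have h1 : edist w z ≤ r :=
        (Metric.edist_le_ediam_of_mem hw.2 hzt).trans (by rw [← hd]; exact_mod_cast hr)
      rw [edist_nndist] at h1
      rw [Metric.mem_closedBall, dist_nndist]
      exact_mod_cast h1
    -- A set of diameter zero is a point, whose mass is controlled by all small balls around it.
    have hr : ∀ᶠ r : ℝ≥0 in 𝓝[>] d, ν (A ∩ t) ≤ (r : ℝ≥0∞) ^ (s : ℝ) := by
      rcases hdr.lt_or_eq with hlt | heq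
      · filter_upwards [Ioc_mem_nhdsGT hlt] with r hr
        exact (measure_mono (hsub r hr.1.le)).trans (h z hzA r (bot_le.trans_lt hr.1) hr.2)
      · filter_upwards [self_mem_nhdsWithin] with r hr
        refine (measure_mono (hsub d le_rfl)).trans ((h z hzA d (heq ▸ hr₀) hdr).trans ?_)
        exact ENNReal.rpow_le_rpow (by exact_mod_cast (le_of_lt hr)) hs'.le
    refine ge_of_tendsto (x := 𝓝[>] d) ?_ hr
    have : Continuous fun r : ℝ≥0 => (r : ℝ≥0∞) ^ (s : ℝ) :=
      (ENNReal.continuous_rpow_const).comp ENNReal.continuous_coe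
    exact (this.tendsto d).mono_left nhdsWithin_le_nhds
  rw [Measure.hausdorffMeasure_apply]
  refine le_iSup₂_of_le (r₀ : ℝ≥0∞) (by exact_mod_cast hr₀) ?_
  refine le_iInf fun t => le_iInf fun hAt => le_iInf fun ht => ?_
  calc ν A ≤ ν (⋃ n, A ∩ t n) := measure_mono fun x hx => by
        obtain ⟨n, hn⟩ := Set.mem_iUnion.1 (hAt hx)
        exact Set.mem_iUnion.2 ⟨n, hx, hn⟩
    _ ≤ ∑' n, ν (A ∩ t n) := measure_iUnion_le _
    _ ≤ _ := ENNReal.tsum_le_tsum fun n => key _ (ht n)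

/-- If every small ball around a point of `A` has mass at least `r ^ s`, then maximal separated
subsets of `A` are small, and `A` has finite `s`-dimensional measure. -/
theorem hausdorffMeasure_ne_top_of_le_closedBall {ν : Measure X} [IsProbabilityMeasure ν]
    {A : Set X} {s : ℝ≥0} {r₀ : ℝ≥0} (hr₀ : 0 < r₀)
    (h : ∀ z ∈ A, ∀ r : ℝ≥0, 0 < r → r ≤ r₀ → (r : ℝ≥0∞) ^ (s : ℝ) ≤ ν (Metric.closedBall z r)) :
    μH[s] A ≠ ∞ := by
  -- A separated set at scale `2 r` has at most `r ^ (-s)` points.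
  have hcard : ∀ r : ℝ≥0, 0 < r → r ≤ r₀ → ∀ F : Finset X, (F : Set X) ⊆ A →
      Metric.IsSeparated (2 * r : ℝ≥0) (F : Set X) → (F.card : ℝ≥0∞) * (r : ℝ≥0∞) ^ (s : ℝ) ≤ 1 := by
    intro r hr hrr F hFA hF
    have hdisj : Set.PairwiseDisjoint (F : Set X) (fun z => Metric.closedBall z (r : ℝ)) := by
      intro x hx y hy hxy
      have h2 : ((2 * r : ℝ≥0) : ℝ≥0∞) < edist x y := hF hx hy hxy
      rw [edist_nndist] at h2
      have h3 : 2 * r < nndist x y := by exact_mod_cast h2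
      refine Metric.closedBall_disjoint_closedBall ?_
      have : ((2 * r : ℝ≥0) : ℝ) < nndist x y := by exact_mod_cast h3
      push_cast at this
      linarith
    calc (F.card : ℝ≥0∞) * (r : ℝ≥0∞) ^ (s : ℝ) = ∑ _z ∈ F, (r : ℝ≥0∞) ^ (s : ℝ) := by
          rw [Finset.sum_const, nsmul_eq_mul]
      _ ≤ ∑ z ∈ F, ν (Metric.closedBall z r) := Finset.sum_le_sum fun z hz => h z (hFA hz) r hr hrr
      _ = ν (⋃ z ∈ F, Metric.closedBall z r) :=
          (measure_biUnion_finset hdisj fun z _ => Metric.isClosed_closedBall.measurableSet).symm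
      _ ≤ 1 := prob_le_one
  have hcover : ∀ r : ℝ≥0, 0 < r → r ≤ r₀ → ∃ F : Finset X,
      A ⊆ ⋃ y ∈ F, Metric.closedEBall y (2 * r : ℝ≥0) ∧
      (F.card : ℝ≥0∞) * (r : ℝ≥0∞) ^ (s : ℝ) ≤ 1 := by
    intro r hr hrr
    have hrs : (r : ℝ≥0∞) ^ (s : ℝ) ≠ 0 := by
      simp [ENNReal.rpow_eq_zero_iff, hr.ne']
    obtain ⟨M, hM⟩ := ENNReal.exists_nat_mul_gt hrs ENNReal.one_ne_top
    have hpack : Metric.packingNumber (2 * r) A ≠ ⊤ := by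
      refine ne_top_of_le_ne_top (ENat.natCast_ne_top M) ?_
      refine iSup₂_le fun C hC => iSup_le fun hsep => ?_
      by_contra! hlt
      obtain ⟨D, hDC, hD⟩ := Set.exists_subset_encard_eq hlt.le
      have hfin : D.Finite := Set.finite_of_encard_eq_coe hD
      have h1 := hcard r hr hrr hfin.toFinset (by simpa using hDC.trans hC)
        (by simpa using hsep.subset hDC)
      have h2 : hfin.toFinset.card = M := by
        rw [hfin.encard_eq_coe_toFinset_card] at hD
        exact_mod_cast hD
      rw [h2] at h1
      exact absurd hM (not_lt.2 h1)
    have hCf : (Metric.maximalSeparatedSet (2 * r) A).Finite := by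
      rw [← Set.encard_ne_top_iff, Metric.encard_maximalSeparatedSet hpack]
      exact hpack
    refine ⟨hCf.toFinset, ?_, hcard r hr hrr _ ?_ ?_⟩
    · simpa using
        Metric.isCover_iff_subset_iUnion_closedEBall.1 (Metric.isCover_maximalSeparatedSet hpack)
    · simpa using Metric.maximalSeparatedSet_subset
    · simpa using Metric.isSeparated_maximalSeparatedSet (ε := 2 * r) (A := A)
  have hex : ∀ n : ℕ, ∃ F : Finset X,
      A ⊆ ⋃ y ∈ F, Metric.closedEBall y (2 * (r₀ / (n + 1)) : ℝ≥0) ∧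
      (F.card : ℝ≥0∞) * ((r₀ / (n + 1) : ℝ≥0) : ℝ≥0∞) ^ (s : ℝ) ≤ 1 := fun n =>
    hcover _ (by positivity) (div_le_self bot_le (by simp))
  choose F hFc hFs using hex
  have hdiam : ∀ n (y : X), Metric.ediam (Metric.closedEBall y (2 * (r₀ / (n + 1)) : ℝ≥0)) ≤
      4 * ((r₀ / (n + 1) : ℝ≥0) : ℝ≥0∞) := by
    intro n y
    refine Metric.ediam_closedEBall_le.trans (le_of_eq ?_)
    rw [ENNReal.coe_mul, ← mul_assoc]
    norm_num
  have hlim : Tendsto (fun n : ℕ => 4 * ((r₀ / ((n : ℝ≥0) + 1) : ℝ≥0) : ℝ≥0∞)) atTop (𝓝 0) := by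
    have h1 : Tendsto (fun n : ℕ => r₀ / ((n : ℝ≥0) + 1)) atTop (𝓝 0) := by
      rw [← NNReal.tendsto_coe]
      have h2 := (tendsto_one_div_add_atTop_nhds_zero_nat (𝕜 := ℝ)).const_mul (r₀ : ℝ)
      simpa [div_eq_mul_inv] using h2
    have h3 := ENNReal.Tendsto.const_mul (a := 4) (ENNReal.tendsto_coe.2 h1) (Or.inr (by simp))
    simpa using h3
  have hle : μH[s] A ≤ (4 : ℝ≥0∞) ^ (s : ℝ) := by
    refine (Measure.hausdorffMeasure_le_liminf_sum (ι := fun n => F n) (s : ℝ) A (l := atTop) _ hlim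
      (fun n y => Metric.closedEBall (y : X) (2 * (r₀ / (n + 1)) : ℝ≥0))
      (Eventually.of_forall fun n y => hdiam n y) (Eventually.of_forall fun n => ?_)).trans ?_
    · refine (hFc n).trans fun x hx => ?_
      obtain ⟨y, hy, hxy⟩ := Set.mem_iUnion₂.1 hx
      exact Set.mem_iUnion.2 ⟨⟨y, hy⟩, hxy⟩
    · refine liminf_le_of_frequently_le' (Frequently.of_forall fun n => ?_)
      calc ∑ y : F n, Metric.ediam (Metric.closedEBall (y : X) (2 * (r₀ / (n + 1)) : ℝ≥0)) ^ (s : ℝ)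
          ≤ ∑ _y : F n, (4 * ((r₀ / (n + 1) : ℝ≥0) : ℝ≥0∞)) ^ (s : ℝ) :=
            Finset.sum_le_sum fun y _ => ENNReal.rpow_le_rpow (hdiam n y) s.coe_nonneg
        _ = 4 ^ (s : ℝ) * ((F n).card * ((r₀ / (n + 1) : ℝ≥0) : ℝ≥0∞) ^ (s : ℝ)) := by
            rw [Finset.sum_const, nsmul_eq_mul, Finset.card_univ, Fintype.card_coe,
              ENNReal.mul_rpow_of_nonneg _ _ s.coe_nonneg]
            ring
        _ ≤ 4 ^ (s : ℝ) := (mul_le_mul_right (hFs n) _).trans_eq (mul_one _)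
  exact (hle.trans_lt (ENNReal.rpow_lt_top_of_nonneg s.coe_nonneg (by simp))).ne

theorem HasExactDim.lowerDimH_ge {ν : Measure X} [IsProbabilityMeasure ν] {δ : ℝ}
    (h : HasExactDim ν δ) : ENNReal.ofReal δ ≤ lowerDimH ν := by
  refine le_iInf fun A => le_iInf fun _ => le_iInf fun hA => ?_
  refine le_of_forall_lt fun c hc => ?_
  obtain ⟨s, hcs, hsδ⟩ := ENNReal.lt_iff_exists_nnreal_btwn.1 hc
  refine hcs.trans_le ?_
  have hs : 0 < s := ENNReal.coe_pos.1 (bot_le.trans_lt hcs)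
  have hsδ' : (s : ℝ) < δ := by
    rw [← ENNReal.ofReal_coe_nnreal] at hsδ
    exact (ENNReal.ofReal_lt_ofReal_iff_of_nonneg s.coe_nonneg).1 hsδ
  let B : ℕ → Set X := fun n => {z | z ∈ A ∧ ∀ r : ℝ≥0, 0 < r → r ≤ 1 / ((n : ℝ≥0) + 1) →
    ν (Metric.closedBall z r) ≤ (r : ℝ≥0∞) ^ (s : ℝ)}
  have hB : ∀ᵐ z ∂ν, z ∈ A → z ∈ ⋃ n, B n := by
    filter_upwards [h] with z hz hzA
    have h1 : ∀ᶠ r : ℝ in 𝓝[>] 0, 0 < r ∧ r < 1 ∧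
        (s : ℝ) < Real.log (ν.real (Metric.closedBall z r)) / Real.log r := by
      filter_upwards [hz.eventually_const_lt hsδ', Ioo_mem_nhdsGT one_pos] with r hr1 hr2
      exact ⟨hr2.1, hr2.2, hr1⟩
    obtain ⟨ε, hε, hεr⟩ := mem_nhdsGT_iff_exists_Ioo_subset.1 h1
    obtain ⟨n, hn⟩ := exists_nat_one_div_lt (show (0 : ℝ) < ε from hε)
    refine Set.mem_iUnion.2 ⟨n, hzA, fun r hr hrn => ?_⟩
    obtain ⟨h0, h1, h2⟩ := hεr (show (r : ℝ) ∈ Set.Ioo 0 ε from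
      ⟨hr, lt_of_le_of_lt (by exact_mod_cast hrn) hn⟩)
    rw [← ENNReal.ofReal_coe_nnreal (p := r), ENNReal.ofReal_rpow_of_pos h0]
    refine (ENNReal.le_ofReal_iff_toReal_le (measure_ne_top _ _) (by positivity)).2 ?_
    change ν.real _ ≤ _
    rcases (measureReal_nonneg (μ := ν) (s := Metric.closedBall z r)).eq_or_lt with h3 | h3
    · rw [← h3]; positivity
    · rw [lt_div_iff_of_neg (Real.log_neg h0 h1)] at h2
      rw [← Real.log_le_log_iff h3 (by positivity), Real.log_rpow h0]
      exact h2.le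
  have hpos : ∃ n, ν (B n) ≠ 0 := by
    by_contra! hcon
    have h2 : ν (⋃ n, B n) = 0 := measure_iUnion_null hcon
    exact hA (measure_mono_null_ae hB h2)
  obtain ⟨n, hn⟩ := hpos
  refine le_dimH_of_hausdorffMeasure_ne_zero fun h0 => hn ?_
  refine le_antisymm ?_ bot_le
  calc ν (B n) ≤ μH[s] (B n) := measure_le_hausdorffMeasure_of_closedBall_le hs
        (r₀ := 1 / ((n : ℝ≥0) + 1)) (by positivity) fun z hz => hz.2
    _ ≤ μH[s] A := measure_mono fun z hz => hz.1
    _ = 0 := h0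

variable [SecondCountableTopology X]

theorem HasExactDim.upperDimH_le {ν : Measure X} [IsProbabilityMeasure ν] {δ : ℝ}
    (h : HasExactDim ν δ) : upperDimH ν ≤ ENNReal.ofReal δ := by
  -- Outside the support the logarithm of a null ball takes the junk value `0`.
  let G : Set X := {z | Tendsto (fun r : ℝ => Real.log (ν.real (Metric.closedBall z r)) / Real.log r)
    (𝓝[>] 0) (𝓝 δ)} ∩ ν.support
  have hG : ν Gᶜ = 0 := by
    have : ∀ᵐ z ∂ν, z ∈ G := by
      filter_upwards [h, Measure.support_mem_ae] with z h1 h2 using ⟨h1, h2⟩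
    exact this
  let A : Set X := (toMeasurable ν Gᶜ)ᶜ
  have hA : A ⊆ G := Set.compl_subset_comm.1 (subset_toMeasurable ν Gᶜ)
  refine iInf_le_of_le A (iInf_le_of_le (measurableSet_toMeasurable _ _).compl
    (iInf_le_of_le (by rw [compl_compl, measure_toMeasurable, hG]) ?_))
  refine (dimH_mono hA).trans ?_
  refine le_of_forall_gt fun c hc => ?_
  obtain ⟨s, hsδ, hcs⟩ := ENNReal.lt_iff_exists_nnreal_btwn.1 hc
  refine lt_of_le_of_lt ?_ hcs
  have hsδ' : δ < s := by
    rw [← ENNReal.ofReal_coe_nnreal] at hsδ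
    exact (ENNReal.ofReal_lt_ofReal_iff'.1 hsδ).1
  let B : ℕ → Set X := fun n => {z | ∀ r : ℝ≥0, 0 < r → r ≤ 1 / ((n : ℝ≥0) + 1) →
    (r : ℝ≥0∞) ^ (s : ℝ) ≤ ν (Metric.closedBall z r)}
  have hB : G ⊆ ⋃ n, B n := by
    rintro z ⟨hz, hzs⟩
    have h1 : ∀ᶠ r : ℝ in 𝓝[>] 0, 0 < r ∧ r < 1 ∧
        Real.log (ν.real (Metric.closedBall z r)) / Real.log r < s := by
      filter_upwards [hz.eventually_lt_const hsδ', Ioo_mem_nhdsGT one_pos] with r hr1 hr2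
      exact ⟨hr2.1, hr2.2, hr1⟩
    obtain ⟨ε, hε, hεr⟩ := mem_nhdsGT_iff_exists_Ioo_subset.1 h1
    obtain ⟨n, hn⟩ := exists_nat_one_div_lt (show (0 : ℝ) < ε from hε)
    refine Set.mem_iUnion.2 ⟨n, fun r hr hrn => ?_⟩
    obtain ⟨h0, h1, h2⟩ := hεr (show (r : ℝ) ∈ Set.Ioo 0 ε from
      ⟨hr, lt_of_le_of_lt (by exact_mod_cast hrn) hn⟩)
    have h3 : 0 < ν.real (Metric.closedBall z r) :=
      ENNReal.toReal_pos ((Measure.mem_support_iff_forall z).1 hzs _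
        (Metric.closedBall_mem_nhds z (by exact_mod_cast hr))).ne' (measure_ne_top _ _)
    rw [← ENNReal.ofReal_coe_nnreal (p := r), ENNReal.ofReal_rpow_of_pos h0]
    refine (ENNReal.ofReal_le_iff_le_toReal (measure_ne_top _ _)).2 ?_
    change _ ≤ ν.real _
    rw [div_lt_iff_of_neg (Real.log_neg h0 h1)] at h2
    rw [← Real.log_le_log_iff (by positivity) h3, Real.log_rpow h0]
    exact h2.le
  calc dimH G ≤ dimH (⋃ n, B n) := dimH_mono hB
    _ = ⨆ n, dimH (B n) := dimH_iUnion _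
    _ ≤ s := iSup_le fun n => dimH_le_of_hausdorffMeasure_ne_top
        (hausdorffMeasure_ne_top_of_le_closedBall (ν := ν) (r₀ := 1 / ((n : ℝ≥0) + 1))
          (by positivity) fun z hz => hz)

end HausdorffDimension

/-! ### Entropy of finite-valued maps -/

/-- The second moment of the information of a probability vector is at most quadratic in the
logarithm of the number of its entries: the information exceeds `log (card W) + x` only with
probability at most `exp (-x)`. -/
theorem sum_mul_log_sq_le {W : Type*} [Fintype W] {p : W → ℝ} (hp : ∀ w, 0 ≤ p w)
    (h1 : ∑ w, p w = 1) :
    ∑ w, p w * Real.log (p w) ^ 2 ≤ 4 + 2 * Real.log (Fintype.card W) ^ 2 := by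
  have hW : 0 < Fintype.card W := Fintype.card_pos_iff.2 <| by
    by_contra h
    rw [not_nonempty_iff] at h
    simp at h1
  set N : ℝ := (Fintype.card W : ℝ) with hN
  have hN0 : 0 < N := Nat.cast_pos.2 hW
  have hN1 : 1 ≤ N := Nat.one_le_cast.2 hW
  have hle1 : ∀ w, p w ≤ 1 := fun w =>
    h1 ▸ Finset.single_le_sum (fun i _ => hp i) (Finset.mem_univ w)
  have key : ∀ w, p w * Real.log (p w) ^ 2 ≤ 4 / N + p w * (2 * Real.log N ^ 2) := by
    intro w
    rcases (hp w).eq_or_lt with h0 | h0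
    · rw [← h0]; simp only [zero_mul, add_zero]; positivity
    have hlog : Real.log (p w) ≤ 0 := Real.log_nonpos (hp w) (hle1 w)
    have hlogN : 0 ≤ Real.log N := Real.log_nonneg hN1
    rcases le_total (-Real.log (p w)) (Real.log N) with h | h
    · have h2 : Real.log (p w) ^ 2 ≤ 2 * Real.log N ^ 2 := by nlinarith
      have := mul_le_mul_of_nonneg_left h2 h0.le
      have : 0 ≤ 4 / N := by positivity
      linarith
    · set g := -Real.log (p w) - Real.log N with hg
      have hg0 : 0 ≤ g := by linarith
      have hexp : Real.exp g = 1 / (p w * N) := by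
        rw [hg, Real.exp_sub, Real.exp_neg, Real.exp_log h0, Real.exp_log hN0]
        field_simp
      have h3 := Real.quadratic_le_exp_of_nonneg hg0
      have h4 : Real.log (p w) ^ 2 ≤ 4 * (1 / (p w * N)) + 2 * Real.log N ^ 2 := by
        rw [← hexp]
        have : Real.log (p w) = -(g + Real.log N) := by rw [hg]; ring
        rw [this]
        nlinarith [sq_nonneg (g - Real.log N)]
      calc p w * Real.log (p w) ^ 2 ≤ p w * (4 * (1 / (p w * N)) + 2 * Real.log N ^ 2) :=
            mul_le_mul_of_nonneg_left h4 h0.le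
        _ = 4 / N + p w * (2 * Real.log N ^ 2) := by field_simp
  calc ∑ w, p w * Real.log (p w) ^ 2 ≤ ∑ w, (4 / N + p w * (2 * Real.log N ^ 2)) :=
        Finset.sum_le_sum fun w _ => key w
    _ = 4 + 2 * Real.log N ^ 2 := by
        rw [Finset.sum_add_distrib, ← Finset.sum_mul, h1, Finset.sum_const, nsmul_eq_mul,
          Finset.card_univ, ← hN]
        field_simp

/-- The entropy of the partition into the nonempty fibres of a finite-valued map. Empty fibres
contribute nothing to the sum on the right. -/
theorem entropy_fibres {Y W : Type} [MeasurableSpace Y] [Fintype W] (b : ℝ) (μ : Measure Y)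
    (φ : Y → W) (P : Set (Set Y)) (hP : ∀ C, C ∈ P ↔ C.Nonempty ∧ ∃ w, C = φ ⁻¹' {w}) :
    entropy b μ P = (∑ w, Real.negMulLog (μ.real (φ ⁻¹' {w}))) / Real.log b := by
  have hP' : P = (fun w => φ ⁻¹' {w}) '' {w | (φ ⁻¹' {w}).Nonempty} := by
    ext C
    rw [hP]
    constructor
    · rintro ⟨h, w, rfl⟩; exact ⟨w, h, rfl⟩
    · rintro ⟨w, h, rfl⟩; exact ⟨h, w, rfl⟩
  have hinj : Set.InjOn (fun w => φ ⁻¹' {w}) {w | (φ ⁻¹' {w}).Nonempty} := by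
    rintro w ⟨y, hy⟩ w' _ h
    have hy' : y ∈ φ ⁻¹' {w'} := h.subset hy
    exact (Set.mem_singleton_iff.1 hy).symm.trans hy'
  unfold entropy
  rw [hP', finsum_mem_image hinj, finsum_mem_def, finsum_eq_sum_of_fintype, Finset.sum_div,
    ← Finset.sum_neg_distrib]
  refine Finset.sum_congr rfl fun w _ => ?_
  by_cases hw : (φ ⁻¹' {w}).Nonempty
  · rw [Set.indicator_of_mem (by exact hw), Real.negMulLog, Real.logb]
    ring
  · rw [Set.indicator_of_notMem (by exact hw), Set.not_nonempty_iff_eq_empty.1 hw]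
    simp

/-! ### Approximate squares -/

variable {m₁ m₂ : ℕ}

/-- The approximate square around `z`: the sequences that agree with `z` in the first `a` letters
and whose second coordinates agree with those of `z` in the first `b` letters. -/
def approxSq (a b : ℕ) (z : Sym m₁ m₂) : Set (Sym m₁ m₂) :=
  {w | (∀ k < a, w k = z k) ∧ ∀ k < b, (w k).2 = (z k).2}

/-- The finite data that determine the approximate square of a sequence. -/
def word (a b : ℕ) (z : Sym m₁ m₂) : (Fin a → Fin m₁ × Fin m₂) × (Fin b → Fin m₂) :=
  (fun k => z k, fun k => (z k).2)

theorem measurable_word (a b : ℕ) : Measurable (word (m₁ := m₁) (m₂ := m₂) a b) := by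
  unfold word; fun_prop

theorem approxSq_eq_preimage (a b : ℕ) (z : Sym m₁ m₂) :
    approxSq a b z = word a b ⁻¹' {word a b z} := by
  ext w
  simp only [approxSq, word, Set.mem_ofPred_eq, Set.mem_preimage, Set.mem_singleton_iff,
    Prod.mk.injEq, funext_iff, Fin.forall_iff]

theorem measurableSet_approxSq (a b : ℕ) (z : Sym m₁ m₂) : MeasurableSet (approxSq a b z) := by
  rw [approxSq_eq_preimage]
  exact measurable_word a b (measurableSet_singleton _)

theorem approxSq_subset {a a' b b' : ℕ} (ha : a ≤ a') (hb : b ≤ b') (z : Sym m₁ m₂) :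
    approxSq a' b' z ⊆ approxSq a b z :=
  fun _ hw => ⟨fun k hk => hw.1 k (hk.trans_le ha), fun k hk => hw.2 k (hk.trans_le hb)⟩

/-- The information `-log ν(Q)` of the approximate square `Q` around `z`. -/
noncomputable def info (ν : Measure (Sym m₁ m₂)) (a b : ℕ) (z : Sym m₁ m₂) : ℝ :=
  -Real.log (ν.real (approxSq a b z))

/-- The Shannon entropy, in natural units, of the partition into approximate squares. -/
noncomputable def squareEntropy (ν : Measure (Sym m₁ m₂)) (a b : ℕ) : ℝ :=
  ∑ w, Real.negMulLog (ν.real (word a b ⁻¹' {w}))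

theorem measurable_info (ν : Measure (Sym m₁ m₂)) (a b : ℕ) : Measurable (info ν a b) := by
  have : info ν a b = (fun w => -Real.log (ν.real (word a b ⁻¹' {w}))) ∘ word a b := by
    ext z; simp [info, approxSq_eq_preimage]
  rw [this]
  exact (measurable_of_countable _).comp (measurable_word a b)

theorem info_nonneg (ν : Measure (Sym m₁ m₂)) [IsProbabilityMeasure ν] (a b : ℕ)
    (z : Sym m₁ m₂) : 0 ≤ info ν a b z :=
  neg_nonneg.2 (Real.log_nonpos measureReal_nonneg measureReal_le_one)

theorem integral_comp_word (ν : Measure (Sym m₁ m₂)) [IsProbabilityMeasure ν] (a b : ℕ)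
    (g : (Fin a → Fin m₁ × Fin m₂) × (Fin b → Fin m₂) → ℝ) :
    ∫ z, g (word a b z) ∂ν = ∑ w, ν.real (word a b ⁻¹' {w}) * g w := by
  have : IsProbabilityMeasure (ν.map (word a b)) :=
    Measure.isProbabilityMeasure_map (measurable_word a b).aemeasurable
  rw [← integral_map (measurable_word a b).aemeasurable
    (measurable_of_countable g).aestronglyMeasurable, integral_fintype .of_finite]
  refine Finset.sum_congr rfl fun w _ => ?_
  rw [map_measureReal_apply (measurable_word a b) (measurableSet_singleton _), smul_eq_mul]

theorem integral_info (ν : Measure (Sym m₁ m₂)) [IsProbabilityMeasure ν] (a b : ℕ) :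
    ∫ z, info ν a b z ∂ν = squareEntropy ν a b := by
  have := integral_comp_word ν a b (fun w => -Real.log (ν.real (word a b ⁻¹' {w})))
  simp only [← approxSq_eq_preimage] at this
  rw [squareEntropy]
  simp only [info]
  rw [this]
  exact Finset.sum_congr rfl fun w _ => by rw [Real.negMulLog]; ring

/-- The information is bounded because it takes finitely many values; on null squares, where it
should be infinite, it takes the value `0`. -/
theorem memLp_info (ν : Measure (Sym m₁ m₂)) [IsProbabilityMeasure ν] (a b : ℕ) :
    MemLp (info ν a b) 2 ν := by
  obtain ⟨C, hC⟩ := (Set.finite_range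
    fun w => ‖-Real.log (ν.real (word (m₁ := m₁) (m₂ := m₂) a b ⁻¹' {w}))‖).bddAbove
  refine MemLp.of_bound (measurable_info ν a b).aestronglyMeasurable C (ae_of_all _ fun z => ?_)
  rw [info, approxSq_eq_preimage]
  exact hC ⟨_, rfl⟩

/-- The second moment of the information grows at most quadratically. -/
theorem integral_info_sq_le (hm₁ : 1 ≤ m₁) (hm₂ : 1 ≤ m₂) (ν : Measure (Sym m₁ m₂))
    [IsProbabilityMeasure ν] {a b : ℕ} (hab : a ≤ b) :
    ∫ z, info ν a b z ^ 2 ∂ν ≤ 4 + 2 * Real.log (m₁ * m₂ * m₂) ^ 2 * b ^ 2 := by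
  have h := integral_comp_word ν a b (fun w => (-Real.log (ν.real (word a b ⁻¹' {w}))) ^ 2)
  simp only [← approxSq_eq_preimage] at h
  have h1 : ∑ w, ν.real (word (m₁ := m₁) (m₂ := m₂) a b ⁻¹' {w}) = 1 := by
    have := integral_comp_word ν a b (fun _ => 1)
    simpa using this.symm
  simp only [info]
  rw [h]
  simp only [neg_sq]
  refine (sum_mul_log_sq_le (fun w => measureReal_nonneg) h1).trans ?_
  have hm₁' : (1 : ℝ) ≤ m₁ := by exact_mod_cast hm₁
  have hm₂' : (1 : ℝ) ≤ m₂ := by exact_mod_cast hm₂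
  have hcard : Real.log (Fintype.card ((Fin a → Fin m₁ × Fin m₂) × (Fin b → Fin m₂))) ≤
      b * Real.log (m₁ * m₂ * m₂) := by
    rw [← Real.log_pow]
    refine Real.log_le_log ?_ ?_
    · simp only [Fintype.card_prod, Fintype.card_fun, Fintype.card_fin]
      positivity
    · simp only [Fintype.card_prod, Fintype.card_fun, Fintype.card_fin]
      push_cast
      rw [mul_pow _ _ b]
      gcongr
      exact one_le_mul_of_one_le_of_one_le hm₁' hm₂'
  have h0 : 0 ≤ Real.log (Fintype.card ((Fin a → Fin m₁ × Fin m₂) × (Fin b → Fin m₂))) :=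
    Real.log_natCast_nonneg _
  have := pow_le_pow_left₀ h0 hcard 2
  rw [mul_pow] at this
  linarith

theorem squareEntropy_nonneg (ν : Measure (Sym m₁ m₂)) [IsProbabilityMeasure ν] (a b : ℕ) :
    0 ≤ squareEntropy ν a b :=
  Finset.sum_nonneg fun _ _ => Real.negMulLog_nonneg measureReal_nonneg measureReal_le_one

theorem squareEntropy_le (hm₁ : 1 ≤ m₁) (hm₂ : 1 ≤ m₂) (ν : Measure (Sym m₁ m₂))
    [IsProbabilityMeasure ν] {a b : ℕ} (hab : a ≤ b) :
    squareEntropy ν a b ≤ 5 + 2 * Real.log (m₁ * m₂ * m₂) ^ 2 * b ^ 2 := by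
  have hint := (memLp_info ν a b).integrable_sq
  have h : ∫ z, info ν a b z ∂ν ≤ ∫ z, (1 + info ν a b z ^ 2) ∂ν :=
    integral_mono ((memLp_info ν a b).integrable one_le_two) ((integrable_const 1).add hint)
      fun z => by nlinarith [sq_nonneg (info ν a b z - 1), info_nonneg ν a b z]
  rw [integral_info, integral_add (integrable_const 1) hint] at h
  have := integral_info_sq_le hm₁ hm₂ ν hab
  simp at h
  linarith

theorem squareEntropy_zero (ν : Measure (Sym m₁ m₂)) [IsProbabilityMeasure ν] :
    squareEntropy ν 0 0 = 0 := by
  have : ∀ z : Sym m₁ m₂, info ν 0 0 z = 0 := fun z => by simp [info, approxSq]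
  rw [← integral_info]
  simp [this]

theorem entropy_alpha1 {Ω : Set (Sym m₁ m₂)} (μ : Measure Ω) (b : ℕ) :
    entropy (m₂ : ℝ) μ (alpha1 Ω b) =
      squareEntropy (μ.map Subtype.val) 0 b / Real.log m₂ := by
  rw [entropy_fibres _ μ (fun z : Ω => word 0 b z.1)]
  · simp only [squareEntropy]
    congr 1
    refine Finset.sum_congr rfl fun w _ => ?_
    rw [map_measureReal_apply measurable_subtype_coe
      (measurable_word 0 b (measurableSet_singleton w))]
    rfl
  · have hfib : ∀ u : (Fin 0 → Fin m₁ × Fin m₂) × (Fin b → Fin m₂),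
        genCyl u = word 0 b ⁻¹' {u} := by
      intro u
      ext z
      simp only [genCyl, word, Set.mem_ofPred_eq, Set.mem_preimage, Set.mem_singleton_iff,
        Prod.ext_iff, funext_iff, zero_add]
    intro C
    constructor
    · rintro ⟨u, ⟨z, hzΩ, hz⟩, rfl⟩
      exact ⟨⟨⟨z, hzΩ⟩, hz⟩, u, by rw [hfib]; rfl⟩
    · rintro ⟨⟨z, hz⟩, u, rfl⟩
      exact ⟨u, ⟨z.1, z.2, by rw [hfib]; exact hz⟩, by rw [hfib]; rfl⟩

theorem entropy_joinPart {Ω : Set (Sym m₁ m₂)} (μ : Measure Ω) (a b : ℕ) :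
    entropy (m₂ : ℝ) μ (joinPart (alpha2 Ω a) (alpha1 Ω b)) =
      squareEntropy (μ.map Subtype.val) a b / Real.log m₂ := by
  rw [entropy_fibres _ μ (fun z : Ω => word a b z.1)]
  · simp only [squareEntropy]
    congr 1
    refine Finset.sum_congr rfl fun w _ => ?_
    rw [map_measureReal_apply measurable_subtype_coe
      (measurable_word a b (measurableSet_singleton w))]
    rfl
  · have hfib : ∀ (u : (Fin a → Fin m₁ × Fin m₂) × (Fin 0 → Fin m₂))
        (v : (Fin 0 → Fin m₁ × Fin m₂) × (Fin b → Fin m₂)),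
        (Subtype.val ⁻¹' genCyl u ∩ Subtype.val ⁻¹' genCyl v : Set Ω) =
          (fun z : Ω => word a b z.1) ⁻¹' {(u.1, v.2)} := by
      intro u v
      ext z
      simp [genCyl, word, Prod.ext_iff, funext_iff]
    intro C
    constructor
    · rintro ⟨hC, _, ⟨u, _, rfl⟩, _, ⟨v, _, rfl⟩, rfl⟩
      exact ⟨hC, _, hfib u v⟩
    · rintro ⟨⟨z, hz⟩, w, rfl⟩
      have h := hfib (w.1, finZeroElim) (finZeroElim, w.2)
      have hz' := hz
      rw [show w = (w.1, w.2) from rfl, ← h] at hz'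
      exact ⟨⟨z, hz⟩, _, ⟨_, ⟨z.1, z.2, hz'.1⟩, rfl⟩, _, ⟨_, ⟨z.1, z.2, hz'.2⟩, rfl⟩, h.symm⟩

/-! ### Balls and geometric progressions -/

theorem seqDist_le_iff_ceil {α : Type} {b r : ℝ} (hb : 1 < b) (hr : 0 < r) {s t : ℕ → α} :
    seqDist b s t ≤ r ↔ ∀ k < ⌈-Real.log r / Real.log b⌉₊, s k = t k := by
  have hlb := Real.log_pos hb
  have hb0 : 0 < b := by linarith
  unfold seqDist
  split_ifs with h
  · subst h; simp [hr.le]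
  · have h1 : (∀ k < ⌈-Real.log r / Real.log b⌉₊, s k = t k) ↔
        ⌈-Real.log r / Real.log b⌉₊ ≤ PiNat.firstDiff s t := by
      rw [← PiNat.mem_cylinder_iff_le_firstDiff h, PiNat.mem_cylinder_iff]
    rw [h1, Nat.ceil_le, div_le_iff₀ hlb, ← Real.log_pow, neg_le, ← Real.log_inv,
      Real.log_le_log_iff (by positivity) hr]

theorem closedBall_eq_approxSq (h₁ : 2 ≤ m₁) (h₂ : 2 ≤ m₂) (z : Sym m₁ m₂) {r : ℝ} (hr : 0 < r) :
    letI : MetricSpace (Sym m₁ m₂) := qsMetric h₁ h₂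
    Metric.closedBall z r =
      approxSq ⌈-Real.log r / Real.log m₁⌉₊ ⌈-Real.log r / Real.log m₂⌉₊ z := by
  let : MetricSpace (Sym m₁ m₂) := qsMetric h₁ h₂
  ext w
  have hb : (1 : ℝ) < m₁ := by exact_mod_cast h₁
  have hc := one_lt_rpow_gam h₁ h₂
  have hlog : Real.log ((m₁ : ℝ) ^ gam m₁ m₂) = Real.log m₂ := by
    rw [Real.log_rpow (by linarith), gam, div_mul_cancel₀ _ (Real.log_pos hb).ne']
  rw [Metric.mem_closedBall]
  change qsDist m₁ m₂ w z ≤ r ↔ _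
  rw [qsDist, max_le_iff, seqDist_le_iff_ceil hb hr, seqDist_le_iff_ceil hc hr, hlog]
  rfl

/-- The number of `l` with `i * q ^ l ≤ n`, for `i ≥ 1` and `q ≥ 2`. -/
def powCount (q n i : ℕ) : ℕ := if i ≤ n then Nat.log q (n / i) + 1 else 0

theorem lt_powCount_iff {q n i l : ℕ} (hq : 2 ≤ q) (hi : 0 < i) :
    l < powCount q n i ↔ i * q ^ l ≤ n := by
  unfold powCount
  split_ifs with h
  · rw [Nat.lt_succ_iff, Nat.le_log_iff_pow_le (by omega) (Nat.div_pos h hi).ne',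
      Nat.le_div_iff_mul_le hi, mul_comm]
  · simp only [not_lt_zero, false_iff, not_le]
    exact (not_le.1 h).trans_le (Nat.le_mul_of_pos_right i (by positivity))

theorem powCount_mono {q n n' : ℕ} (hq : 2 ≤ q) (h : n ≤ n') {i : ℕ} (hi : 0 < i) :
    powCount q n i ≤ powCount q n' i := by
  by_contra! hlt
  have := (lt_powCount_iff hq hi).1 hlt
  exact lt_irrefl _ ((lt_powCount_iff hq hi).2 (this.trans h))

/-- The indices `1 ≤ i ≤ n` not divisible by `q`: the first terms of the geometric progressions of
ratio `q` that meet `{1, …, n}`. -/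
def starts (q n : ℕ) : Finset ℕ := (Finset.Icc 1 n).filter fun i => ¬ q ∣ i

theorem pos_of_mem_starts {q n i : ℕ} (hi : i ∈ starts q n) : 0 < i :=
  (Finset.mem_Icc.1 (Finset.mem_filter.1 hi).1).1

theorem along_assemble {q i : ℕ} (hq : 2 ≤ q) (hi : ¬ q ∣ i) (ω : ℕ → Sym m₁ m₂) :
    along q i (assemble q ω) = ω i :=
  funext fun l => assemble_mul_pow hq hi l ω

theorem assemble_mem_approxSq_iff {q n L : ℕ} (hq : 2 ≤ q) (hnL : n ≤ L)
    (ω ω' : ℕ → Sym m₁ m₂) : assemble q ω' ∈ approxSq n L (assemble q ω) ↔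
      ∀ i ∈ starts q L, ω' i ∈ approxSq (powCount q n i) (powCount q L i) (ω i) := by
  have hq0 : 0 < q := by omega
  constructor
  · intro h i hi
    have hi0 := pos_of_mem_starts hi
    have hqi : ¬ q ∣ i := (Finset.mem_filter.1 hi).2
    refine ⟨fun l hl => ?_, fun l hl => ?_⟩ <;>
    · rw [← assemble_mul_pow hq hqi l ω, ← assemble_mul_pow hq hqi l ω']
      have h1 := (lt_powCount_iff hq hi0).1 hl
      have h2 : 0 < i * q ^ l := by positivity
      first | exact h.1 _ (by omega) | exact h.2 _ (by omega)
  · intro h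
    have key : ∀ k, k < L → ∃ i ∈ starts q L, ∃ l, i * q ^ l = k + 1 ∧
        assemble q ω k = ω i l ∧ assemble q ω' k = ω' i l := by
      intro k hk
      obtain ⟨i, l, hqi, hil⟩ := exists_eq_mul_pow hq k
      have hi0 : 0 < i := Nat.pos_of_ne_zero (by rintro rfl; simp at hqi)
      have hk' : k = i * q ^ l - 1 := by omega
      have hiL : i ≤ i * q ^ l := Nat.le_mul_of_pos_right i (by positivity)
      refine ⟨i, Finset.mem_filter.2 ⟨Finset.mem_Icc.2 ⟨hi0, by omega⟩, hqi⟩, l, hil, ?_, ?_⟩ <;>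
        rw [hk', assemble_mul_pow hq hqi]
    refine ⟨fun k hk => ?_, fun k hk => ?_⟩
    · obtain ⟨i, hi, l, hil, e₁, e₂⟩ := key k (hk.trans_le hnL)
      rw [e₁, e₂]
      exact (h i hi).1 l ((lt_powCount_iff hq (pos_of_mem_starts hi)).2 (by omega))
    · obtain ⟨i, hi, l, hil, e₁, e₂⟩ := key k hk
      rw [e₁, e₂]
      exact (h i hi).2 l ((lt_powCount_iff hq (pos_of_mem_starts hi)).2 (by omega))

section Measure

variable {Ω : Set (Sym m₁ m₂)} (μ : Measure Ω)

/-- The law of the independent sequence of points of `Ω` from which `ℙ_μ` is assembled. -/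
noncomputable def seqLaw : Measure (ℕ → Sym m₁ m₂) :=
  Measure.infinitePi fun _ : ℕ => μ.map Subtype.val

theorem ae_PMeas_of_ae_seqLaw {q : ℕ} {p : Sym m₁ m₂ → Prop} (hp : MeasurableSet {z | p z})
    (h : ∀ᵐ ω ∂seqLaw μ, p (assemble q ω)) : ∀ᵐ z ∂PMeas q μ, p z :=
  (ae_map_iff (measurable_assemble q).aemeasurable hp).2 h

variable [IsProbabilityMeasure μ]

instance : IsProbabilityMeasure (μ.map Subtype.val) :=
  Measure.isProbabilityMeasure_map measurable_subtype_coe.aemeasurable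

instance : IsProbabilityMeasure (seqLaw μ) := by unfold seqLaw; infer_instance

theorem PMeas_approxSq {q n L : ℕ} (hq : 2 ≤ q) (hnL : n ≤ L) (ω : ℕ → Sym m₁ m₂) :
    (PMeas q μ).real (approxSq n L (assemble q ω)) =
      ∏ i ∈ starts q L, (μ.map Subtype.val).real
        (approxSq (powCount q n i) (powCount q L i) (ω i)) := by
  have hpre : assemble q ⁻¹' approxSq n L (assemble q ω) =
      Set.pi (starts q L : Set ℕ)
        (fun i => approxSq (powCount q n i) (powCount q L i) (ω i)) := by
    ext ω'
    exact assemble_mem_approxSq_iff hq hnL ω ω'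
  simp only [Measure.real]
  rw [PMeas, Measure.map_apply (measurable_assemble q) (measurableSet_approxSq _ _ _), hpre,
    Measure.infinitePi_pi _ (fun _ _ => measurableSet_approxSq _ _ _), ENNReal.toReal_prod]

/-- Almost every point has no null approximate square around it. -/
theorem ae_approxSq_pos (ν : Measure (Sym m₁ m₂)) [IsProbabilityMeasure ν] :
    ∀ᵐ z ∂ν, ∀ a b : ℕ, 0 < ν.real (approxSq a b z) := by
  refine ae_all_iff.2 fun a => ae_all_iff.2 fun b => ?_
  have h : ∀ w, ∀ᵐ z ∂ν, word a b z = w → 0 < ν.real (approxSq a b z) := by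
    intro w
    by_cases hw : ν (word a b ⁻¹' {w}) = 0
    · filter_upwards [measure_eq_zero_iff_ae_notMem.1 hw] with z hz hzw
      exact absurd hzw hz
    · refine ae_of_all _ fun z hz => ?_
      rw [approxSq_eq_preimage, hz]
      exact ENNReal.toReal_pos hw (measure_ne_top _ _)
  filter_upwards [ae_all_iff.2 h] with z hz
  exact hz _ rfl

theorem ae_seqLaw_eval {p : Sym m₁ m₂ → Prop} (h : ∀ᵐ z ∂(μ.map Subtype.val), p z) :
    ∀ᵐ ω ∂seqLaw μ, ∀ i, p (ω i) :=
  ae_all_iff.2 fun i =>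
    (measurePreserving_eval_infinitePi (fun _ : ℕ => μ.map Subtype.val) i).quasiMeasurePreserving.ae
      h

/-- The measure of an approximate square in terms of the informations along progressions. -/
theorem ae_neg_log_PMeas_approxSq {q : ℕ} (hq : 2 ≤ q) :
    ∀ᵐ ω ∂seqLaw μ, ∀ n L, n ≤ L →
      -Real.log ((PMeas q μ).real (approxSq n L (assemble q ω))) =
        ∑ i ∈ starts q L, info (μ.map Subtype.val) (powCount q n i) (powCount q L i) (ω i) := by
  filter_upwards [ae_seqLaw_eval μ (ae_approxSq_pos (μ.map Subtype.val))] with ω hω n L hnL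
  rw [PMeas_approxSq μ hq hnL, Real.log_prod fun i _ => (hω i _ _).ne', ← Finset.sum_neg_distrib]
  rfl

theorem PMeas_compl_XSet {q : ℕ} (hq : 2 ≤ q) (hΩ : IsClosed Ω) :
    PMeas q μ (XSet q Ω)ᶜ = 0 := by
  have hm : MeasurableSet {z : Sym m₁ m₂ | z ∈ XSet q Ω} := by
    have : {z : Sym m₁ m₂ | z ∈ XSet q Ω} =
        ⋂ i : ℕ, ⋂ _ : ¬ q ∣ i, along q i ⁻¹' Ω := by
      ext z; simp [XSet]
    rw [this]
    refine MeasurableSet.iInter fun i => MeasurableSet.iInter fun _ => ?_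
    have hal : Measurable (along (m₁ := m₁) (m₂ := m₂) q i) := by unfold along; fun_prop
    exact hal hΩ.measurableSet
  refine ae_PMeas_of_ae_seqLaw μ hm ?_
  have h : ∀ᵐ z ∂(μ.map Subtype.val), z ∈ Ω :=
    (ae_map_iff measurable_subtype_coe.aemeasurable hΩ.measurableSet).2 (ae_of_all _ fun z => z.2)
  filter_upwards [ae_seqLaw_eval μ h] with ω hω i hi
  rw [along_assemble hq hi]
  exact hω i

end Measure

/-! ### Averages over geometric progressions -/

theorem card_starts (q n : ℕ) : ((starts q n).card : ℝ) = n - (n / q : ℕ) := by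
  have h := Finset.card_filter_add_card_filter_not (s := Finset.Icc 1 n) (fun i => q ∣ i)
  have h1 : ((Finset.Icc 1 n).filter fun i => q ∣ i).card = n / q :=
    Nat.Ioc_filter_dvd_card_eq_div n q
  rw [h1, Nat.card_Icc, Nat.add_sub_cancel] at h
  have h2 : n / q + (starts q n).card = n := h
  have h3 : ((n / q : ℕ) : ℝ) + (starts q n).card = n := by exact_mod_cast h2
  linarith

theorem card_starts_le (q n : ℕ) : (starts q n).card ≤ n :=
  (Finset.card_filter_le _ _).trans (by simp)

/-- Exchanging the sums over progressions and over their terms. -/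
theorem sum_range_powCount {q n N : ℕ} (hq : 2 ≤ q) (hnN : n ≤ N) (g : ℕ → ℝ) :
    ∑ i ∈ starts q N, ∑ l ∈ Finset.range (powCount q n i), g l =
      ∑' l, (starts q (n / q ^ l)).card * g l := by
  have hlt : ∀ i ∈ starts q N, ∀ l, i * q ^ l ≤ n → l < n := fun i hi l h =>
    (Nat.lt_pow_self (by omega)).trans_le
      ((Nat.le_mul_of_pos_left (q ^ l) (pos_of_mem_starts hi)).trans h)
  have h1 : ∀ i ∈ starts q N, ∑ l ∈ Finset.range (powCount q n i), g l =
      ∑ l ∈ Finset.range n, if i * q ^ l ≤ n then g l else 0 := by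
    intro i hi
    rw [← Finset.sum_filter]
    refine Finset.sum_congr ?_ fun _ _ => rfl
    ext l
    simp only [Finset.mem_range, Finset.mem_filter, lt_powCount_iff hq (pos_of_mem_starts hi)]
    exact ⟨fun h => ⟨hlt i hi l h, h⟩, fun h => h.2⟩
  rw [Finset.sum_congr rfl h1, Finset.sum_comm, tsum_eq_sum (s := Finset.range n)]
  · refine Finset.sum_congr rfl fun l _ => ?_
    have hpow : 0 < q ^ l := by positivity
    rw [← Finset.sum_filter, Finset.sum_const, nsmul_eq_mul]
    congr 3
    ext i
    simp only [starts, Finset.mem_filter, Finset.mem_Icc, Nat.le_div_iff_mul_le hpow]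
    constructor
    · rintro ⟨⟨⟨h1, -⟩, h2⟩, h3⟩
      exact ⟨⟨h1, h3⟩, h2⟩
    · rintro ⟨⟨h1, h3⟩, h2⟩
      exact ⟨⟨⟨h1, ((Nat.le_mul_of_pos_right i hpow).trans h3).trans hnN⟩, h2⟩, h3⟩
  · intro l hl
    rw [Finset.mem_range, not_lt] at hl
    rw [Nat.div_eq_of_lt (hl.trans_lt (Nat.lt_pow_self (by omega)))]
    simp [starts]

theorem summable_div_pow {q : ℕ} (hq : 2 ≤ q) {g : ℕ → ℝ} {C : ℝ}
    (hg : ∀ l, |g l| ≤ C * ((l : ℝ) + 1) ^ 2) : Summable fun l => |g l| / (q : ℝ) ^ l := by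
  have hq1 : (1 : ℝ) < q := by exact_mod_cast hq
  have h := (summable_nat_add_iff 1).2 (summable_pow_mul_geometric_of_norm_lt_one 2
    (r := (q : ℝ)⁻¹) (by rw [norm_inv, Real.norm_natCast]; exact inv_lt_one_of_one_lt₀ hq1))
  refine Summable.of_nonneg_of_le (fun l => by positivity) (fun l => ?_) (h.mul_left (C * q))
  rw [div_le_iff₀ (by positivity)]
  refine (hg l).trans (le_of_eq ?_)
  push_cast
  rw [inv_pow]
  field_simp
  ring

theorem tendsto_card_starts_div {q : ℕ} (hq : 2 ≤ q) (l : ℕ) :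
    Tendsto (fun n : ℕ => ((starts q (n / q ^ l)).card : ℝ) / n) atTop
      (𝓝 ((1 - 1 / (q : ℝ)) / (q : ℝ) ^ l)) := by
  have hdiv : ∀ d : ℕ, Tendsto (fun n : ℕ => ((n / d : ℕ) : ℝ) / n) atTop (𝓝 (1 / (d : ℝ))) := by
    intro d
    have h := (tendsto_nat_floor_mul_div_atTop (R := ℝ) (a := 1 / (d : ℝ)) (by positivity)).comp
      (tendsto_natCast_atTop_atTop (R := ℝ))
    refine h.congr fun n => ?_
    simp only [Function.comp_apply]
    rw [one_div_mul_eq_div, Nat.floor_div_eq_div]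
  have h := (hdiv (q ^ l)).sub (hdiv (q ^ l * q))
  have e : (1 - 1 / (q : ℝ)) / (q : ℝ) ^ l = 1 / ((q ^ l : ℕ) : ℝ) - 1 / ((q ^ l * q : ℕ) : ℝ) := by
    have : (q : ℝ) ≠ 0 := by positivity
    push_cast
    field_simp
  rw [e]
  refine h.congr fun n => ?_
  rw [card_starts, Nat.div_div_eq_div_mul, sub_div]

/-- The number of progressions whose term of index `l` is at most `n` is asymptotic to
`(1 - 1 / q) n / q ^ l`, and the sum over `l` passes to the limit by dominated convergence. -/
theorem tendsto_tsum_card_starts {q : ℕ} (hq : 2 ≤ q) {g : ℕ → ℝ} {C : ℝ}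
    (hg : ∀ l, |g l| ≤ C * ((l : ℝ) + 1) ^ 2) :
    Tendsto (fun n : ℕ => (∑' l, (starts q (n / q ^ l)).card * g l) / n) atTop
      (𝓝 ((1 - 1 / (q : ℝ)) * ∑' l, g l / (q : ℝ) ^ l)) := by
  have h := tendsto_tsum_of_dominated_convergence (𝓕 := atTop)
    (f := fun (n : ℕ) (l : ℕ) => ((starts q (n / q ^ l)).card : ℝ) / n * g l)
    (g := fun l => (1 - 1 / (q : ℝ)) / (q : ℝ) ^ l * g l) (summable_div_pow hq hg)
    (fun l => (tendsto_card_starts_div hq l).mul_const _) (Eventually.of_forall fun n l => ?_)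
  · rw [← tsum_mul_left]
    refine (h.congr fun n => ?_).trans_eq ?_
    · rw [← tsum_div_const]
      exact tsum_congr fun l => by ring
    · congr 1
      exact tsum_congr fun l => by ring
  · rw [norm_mul, Real.norm_eq_abs (g l), Real.norm_of_nonneg (by positivity), mul_comm,
      div_eq_mul_inv (|g l|)]
    refine mul_le_mul_of_nonneg_left ?_ (abs_nonneg _)
    rcases Nat.eq_zero_or_pos n with rfl | hn
    · simp
    rw [div_le_iff₀ (by positivity)]
    calc ((starts q (n / q ^ l)).card : ℝ) ≤ (n / q ^ l : ℕ) := by exact_mod_cast card_starts_le _ _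
      _ ≤ (n : ℝ) / ((q ^ l : ℕ) : ℝ) := Nat.cast_div_le
      _ = ((q : ℝ) ^ l)⁻¹ * n := by push_cast; rw [div_eq_inv_mul]

/-! ### Telescoping the entropies -/

/-- The increment of `H` when the number of known `y`-letters grows from `l` to `l + 1`. -/
def stepY (H : ℕ → ℕ → ℝ) (j l : ℕ) : ℝ := H (l - j) (l + 1) - H (l - j) l

/-- The increment of `H` when the number of fully known letters grows from `l` to `l + 1`. -/
def stepX (H : ℕ → ℕ → ℝ) (j l : ℕ) : ℝ := H (l + 1) (j + 1 + l) - H l (j + 1 + l)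

/-- As the scale decreases, the pair of lengths runs through
`(0, 0), (0, 1), …, (0, j + 1), (1, j + 1), (1, j + 2), (2, j + 2), …`. -/
theorem sum_steps {H : ℕ → ℕ → ℝ} (h0 : H 0 0 = 0) (j : ℕ) {a b : ℕ}
    (hab : a = b - j ∨ a = b - (j + 1)) :
    ∑ l ∈ Finset.range b, stepY H j l + ∑ l ∈ Finset.range a, stepX H j l = H a b := by
  have hX : ∀ c, ∑ l ∈ Finset.range (c + 1), stepX H j l =
      ∑ l ∈ Finset.range c, stepX H j l + H (c + 1) (j + 1 + c) - H c (j + 1 + c) := fun c => by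
    rw [Finset.sum_range_succ, stepX]; ring
  have hF : ∀ b, ∑ l ∈ Finset.range b, stepY H j l +
      ∑ l ∈ Finset.range (b - (j + 1)), stepX H j l = H (b - (j + 1)) b := by
    intro b
    induction b with
    | zero => simp [h0]
    | succ b ih =>
      rw [Finset.sum_range_succ, stepY, Nat.add_sub_add_right]
      rcases le_or_gt b j with hb | hb
      · rw [Nat.sub_eq_zero_of_le hb]
        rw [Nat.sub_eq_zero_of_le (by omega)] at ih
        linarith
      · obtain ⟨c, rfl⟩ : ∃ c, b = j + 1 + c := ⟨b - (j + 1), by omega⟩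
        rw [show j + 1 + c - j = c + 1 by omega, hX]
        rw [show j + 1 + c - (j + 1) = c by omega] at ih
        linarith
  rcases hab with rfl | rfl
  · have ih := hF b
    rcases le_or_gt b j with hb | hb
    · rw [Nat.sub_eq_zero_of_le hb]
      rwa [Nat.sub_eq_zero_of_le (by omega)] at ih
    · obtain ⟨c, rfl⟩ : ∃ c, b = j + 1 + c := ⟨b - (j + 1), by omega⟩
      rw [show j + 1 + c - j = c + 1 by omega, hX]
      rw [show j + 1 + c - (j + 1) = c by omega] at ih
      linarith
  · exact hF b

/-- Since `γ` lies between `q ^ (-(j + 1))` and `q ^ (-j)`, shrinking the range by the factor `γ`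
removes `j` or `j + 1` terms of each progression. -/
theorem powCount_floor {q j : ℕ} (hq : 2 ≤ q) {γ : ℝ} (hγ : 0 ≤ γ) (h₁ : (q : ℝ) ^ j * γ ≤ 1)
    (h₂ : 1 ≤ (q : ℝ) ^ (j + 1) * γ) (N : ℕ) {i : ℕ} (hi : 0 < i) :
    powCount q ⌊γ * N⌋₊ i = powCount q N i - j ∨
      powCount q ⌊γ * N⌋₊ i = powCount q N i - (j + 1) := by
  set a := powCount q ⌊γ * N⌋₊ i with ha
  set b := powCount q N i with hb
  have hN : (0 : ℝ) ≤ N := Nat.cast_nonneg N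
  have hq0 : (0 : ℝ) < q := by positivity
  have hA : ∀ l, l < a ↔ (i : ℝ) * (q : ℝ) ^ l ≤ γ * N := fun l => by
    rw [ha, lt_powCount_iff hq hi, Nat.le_floor_iff (by positivity)]
    push_cast; rfl
  have hB : ∀ l, l < b ↔ (i : ℝ) * (q : ℝ) ^ l ≤ N := fun l => by
    rw [hb, lt_powCount_iff hq hi]
    exact_mod_cast Iff.rfl
  have h3 : a ≤ b - j := by
    rcases Nat.eq_zero_or_pos a with h | h
    · omega
    have h4 := (hA (a - 1)).1 (by omega)
    have h5 : a - 1 + j < b := by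
      rw [hB, pow_add, ← mul_assoc]
      calc (i : ℝ) * (q : ℝ) ^ (a - 1) * (q : ℝ) ^ j ≤ γ * N * (q : ℝ) ^ j := by gcongr
        _ = ((q : ℝ) ^ j * γ) * N := by ring
        _ ≤ 1 * N := by gcongr
        _ = N := one_mul _
    omega
  have h4 : b - (j + 1) ≤ a := by
    by_contra! hlt
    have h5 := (hB (a + (j + 1))).1 (by omega)
    refine lt_irrefl a ((hA a).2 ?_)
    rw [pow_add, ← mul_assoc] at h5
    have h6 : (0 : ℝ) < (q : ℝ) ^ (j + 1) := by positivity
    refine le_of_mul_le_mul_right ?_ h6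
    calc (i : ℝ) * (q : ℝ) ^ a * (q : ℝ) ^ (j + 1) ≤ 1 * N := by rwa [one_mul]
      _ ≤ ((q : ℝ) ^ (j + 1) * γ) * N := by gcongr
      _ = γ * N * (q : ℝ) ^ (j + 1) := by ring
  omega

section Growth

variable {H : ℕ → ℕ → ℝ} {C : ℝ} (hH : ∀ a b, a ≤ b → |H a b| ≤ C * ((b : ℝ) + 1) ^ 2)
include hH

theorem abs_stepY_le (j l : ℕ) : |stepY H j l| ≤ 5 * C * ((l : ℝ) + 1) ^ 2 := by
  have hC : 0 ≤ C := by simpa using (abs_nonneg _).trans (hH 0 0 le_rfl)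
  have h1 := hH (l - j) (l + 1) (by omega)
  have h2 := hH (l - j) l (by omega)
  have hl : (0 : ℝ) ≤ l := Nat.cast_nonneg l
  have h3 : ((l + 1 : ℕ) + 1 : ℝ) ^ 2 ≤ 4 * ((l : ℝ) + 1) ^ 2 := by push_cast; nlinarith
  have h4 := mul_le_mul_of_nonneg_left h3 hC
  refine (abs_sub _ _).trans ?_
  linarith

theorem abs_stepX_le (j l : ℕ) : |stepX H j l| ≤ 2 * C * ((j : ℝ) + 2) ^ 2 * ((l : ℝ) + 1) ^ 2 := by
  have hC : 0 ≤ C := by simpa using (abs_nonneg _).trans (hH 0 0 le_rfl)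
  have h1 := hH (l + 1) (j + 1 + l) (by omega)
  have h2 := hH l (j + 1 + l) (by omega)
  have hl : (0 : ℝ) ≤ l := Nat.cast_nonneg l
  have hj : (0 : ℝ) ≤ j := Nat.cast_nonneg j
  have h3 : ((j + 1 + l : ℕ) + 1 : ℝ) ^ 2 ≤ (((j : ℝ) + 2) * ((l : ℝ) + 1)) ^ 2 := by
    push_cast
    gcongr
    nlinarith
  rw [mul_pow] at h3
  have h4 := mul_le_mul_of_nonneg_left h3 hC
  refine (abs_sub _ _).trans ?_
  linarith

theorem summable_termX {q : ℕ} (hq : 2 ≤ q) (j : ℕ) :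
    Summable fun k => H (k + 1) (j + 1 + k) / (q : ℝ) ^ (j + 1 + k + 1) := by
  have hC : 0 ≤ C := by simpa using (abs_nonneg _).trans (hH 0 0 le_rfl)
  have h := summable_div_pow hq (g := fun l => C * ((l : ℝ) + 1) ^ 2) (C := C)
    fun l => (abs_of_nonneg (by positivity)).le
  refine Summable.of_norm_bounded ((summable_nat_add_iff (j + 1)).2 h) fun k => ?_
  have hq1 : (1 : ℝ) ≤ q := by exact_mod_cast (by omega : 1 ≤ q)
  rw [norm_div, Real.norm_eq_abs, norm_pow, Real.norm_natCast, add_comm k (j + 1)]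
  refine div_le_div₀ (abs_nonneg _) ((hH _ _ (by omega)).trans (le_abs_self _)) (by positivity)
    (pow_le_pow_right₀ hq1 (by omega))

theorem summable_termY {q : ℕ} (hq : 2 ≤ q) (j : ℕ) :
    Summable fun k => H k (j + 1 + k) / (q : ℝ) ^ (j + 1 + k) := by
  have hC : 0 ≤ C := by simpa using (abs_nonneg _).trans (hH 0 0 le_rfl)
  have h := summable_div_pow hq (g := fun l => C * ((l : ℝ) + 1) ^ 2) (C := C)
    fun l => (abs_of_nonneg (by positivity)).le
  refine Summable.of_norm_bounded ((summable_nat_add_iff (j + 1)).2 h) fun k => ?_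
  rw [norm_div, Real.norm_eq_abs, norm_pow, Real.norm_natCast, add_comm k (j + 1)]
  exact div_le_div_of_nonneg_right ((hH _ _ (by omega)).trans (le_abs_self _)) (by positivity)

/-- Summation by parts turns the series of increments into the series of the dimension formula. -/
theorem tsum_steps {q : ℕ} (hq : 2 ≤ q) (h0 : H 0 0 = 0) (j : ℕ) (γ : ℝ) :
    (1 - 1 / (q : ℝ)) * (∑' l, stepY H j l / (q : ℝ) ^ l + γ * ∑' l, stepX H j l / (q : ℝ) ^ l) =
      ((q : ℝ) - 1) ^ 2 * ∑ p ∈ Finset.Icc 1 j, H 0 p / (q : ℝ) ^ (p + 1)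
      + ((q : ℝ) - 1) * ((q : ℝ) ^ (j + 1) * γ - 1) *
        ∑' k, H (k + 1) (j + 1 + k) / (q : ℝ) ^ (j + 1 + k + 1)
      + ((q : ℝ) - 1) * (1 - (q : ℝ) ^ j * γ) * ∑' k, H k (j + 1 + k) / (q : ℝ) ^ (j + 1 + k) := by
  have hq0 : (q : ℝ) ≠ 0 := by positivity
  have sA := summable_termX hH hq j
  have sB := summable_termY hH hq j
  set A := ∑' k, H (k + 1) (j + 1 + k) / (q : ℝ) ^ (j + 1 + k + 1) with hA
  set B := ∑' k, H k (j + 1 + k) / (q : ℝ) ^ (j + 1 + k) with hB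
  have eX : ∑' l, stepX H j l / (q : ℝ) ^ l = (q : ℝ) ^ (j + 2) * A - (q : ℝ) ^ (j + 1) * B := by
    rw [hA, hB, ← tsum_mul_left, ← tsum_mul_left,
      ← (sA.mul_left _).tsum_sub (sB.mul_left _)]
    refine tsum_congr fun k => ?_
    rw [stepX, pow_add (q : ℝ) (j + 1) k, show j + 1 + k + 1 = j + 2 + k by ring,
      pow_add (q : ℝ) (j + 2) k]
    field_simp
  have sY : Summable fun l => stepY H j l / (q : ℝ) ^ l := by
    refine Summable.of_norm ((summable_div_pow hq (abs_stepY_le hH j)).congr fun l => ?_)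
    rw [norm_div, Real.norm_eq_abs, norm_pow, Real.norm_natCast]
  have eB : ∑' k, H (k + 1) (j + 1 + (k + 1)) / (q : ℝ) ^ (j + 1 + (k + 1)) =
      B - H 0 (j + 1) / (q : ℝ) ^ (j + 1) := by
    rw [hB, sB.tsum_eq_zero_add]
    simp
  have sB' := (summable_nat_add_iff 1).2 sB
  have eY' : ∑' k, stepY H j (k + (j + 1)) / (q : ℝ) ^ (k + (j + 1)) =
      q * (B - H 0 (j + 1) / (q : ℝ) ^ (j + 1)) - q * A := by
    rw [← eB, hA, ← tsum_mul_left, ← tsum_mul_left,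
      ← (sB'.mul_left _).tsum_sub (sA.mul_left _)]
    refine tsum_congr fun k => ?_
    rw [stepY, show k + (j + 1) - j = k + 1 by omega, show k + (j + 1) + 1 = j + 1 + (k + 1) by ring,
      show k + (j + 1) = j + 1 + k by ring, show j + 1 + (k + 1) = j + 1 + k + 1 by ring,
      pow_succ (q : ℝ) (j + 1 + k)]
    field_simp
  have eF : ∀ j : ℕ, ∑ l ∈ Finset.range (j + 1), (H 0 (l + 1) - H 0 l) / (q : ℝ) ^ l =
      (q : ℝ) * (q - 1) * ∑ p ∈ Finset.Icc 1 j, H 0 p / (q : ℝ) ^ (p + 1)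
        + H 0 (j + 1) / (q : ℝ) ^ j := by
    intro j
    induction j with
    | zero => simp [h0]
    | succ j ih =>
      rw [Finset.sum_range_succ, ih, Finset.sum_Icc_succ_top (by omega)]
      rw [pow_succ, pow_succ (q : ℝ) (j + 1), pow_succ]
      field_simp
      ring
  have eY : ∑' l, stepY H j l / (q : ℝ) ^ l =
      (q : ℝ) * (q - 1) * ∑ p ∈ Finset.Icc 1 j, H 0 p / (q : ℝ) ^ (p + 1) + q * B - q * A := by
    rw [← sY.sum_add_tsum_nat_add (j + 1), eY']
    have : ∑ l ∈ Finset.range (j + 1), stepY H j l / (q : ℝ) ^ l =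
        ∑ l ∈ Finset.range (j + 1), (H 0 (l + 1) - H 0 l) / (q : ℝ) ^ l := by
      refine Finset.sum_congr rfl fun l hl => ?_
      rw [stepY, Nat.sub_eq_zero_of_le (Nat.lt_succ_iff.1 (Finset.mem_range.1 hl))]
    rw [this, eF, pow_succ]
    field_simp
    ring
  rw [eX, eY, pow_succ (q : ℝ) (j + 1)]
  field_simp
  ring

/-- The asymptotic expected information at scale `N`. -/
theorem tendsto_sum_starts {q : ℕ} (hq : 2 ≤ q) (h0 : H 0 0 = 0) {j : ℕ} {γ : ℝ} (hγ : 0 ≤ γ)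
    (hγ1 : γ ≤ 1) (h₁ : (q : ℝ) ^ j * γ ≤ 1) (h₂ : 1 ≤ (q : ℝ) ^ (j + 1) * γ) :
    Tendsto (fun N : ℕ => (∑ i ∈ starts q N,
        H (powCount q ⌊γ * N⌋₊ i) (powCount q N i)) / (N : ℝ)) atTop
      (𝓝 ((1 - 1 / (q : ℝ)) *
        (∑' l, stepY H j l / (q : ℝ) ^ l + γ * ∑' l, stepX H j l / (q : ℝ) ^ l))) := by
  have hY := tendsto_tsum_card_starts hq (abs_stepY_le hH j)
  have hX := tendsto_tsum_card_starts hq (abs_stepX_le hH j)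
  have hfl : Tendsto (fun N : ℕ => (⌊γ * N⌋₊ : ℝ) / N) atTop (𝓝 γ) :=
    (tendsto_nat_floor_mul_div_atTop (R := ℝ) hγ).comp tendsto_natCast_atTop_atTop
  have hγ0 : 0 < γ := by
    rcases hγ.eq_or_lt with h | h
    · rw [← h, mul_zero] at h₂; linarith
    · exact h
  have htop : Tendsto (fun N : ℕ => ⌊γ * N⌋₊) atTop atTop :=
    tendsto_nat_floor_atTop.comp (tendsto_natCast_atTop_atTop.const_mul_atTop hγ0)
  have h := hY.add (hfl.mul (hX.comp htop))
  rw [mul_add, mul_left_comm]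
  refine h.congr fun N => ?_
  have hle : ⌊γ * N⌋₊ ≤ N :=
    Nat.floor_le_of_le (mul_le_of_le_one_left (Nat.cast_nonneg N) hγ1)
  have e : ∑ i ∈ starts q N, H (powCount q ⌊γ * N⌋₊ i) (powCount q N i) =
      ∑' l, (starts q (N / q ^ l)).card * stepY H j l +
      ∑' l, (starts q (⌊γ * N⌋₊ / q ^ l)).card * stepX H j l := by
    rw [← sum_range_powCount hq le_rfl, ← sum_range_powCount hq hle, ← Finset.sum_add_distrib]
    exact Finset.sum_congr rfl fun i hi =>
      (sum_steps h0 j (powCount_floor hq hγ h₁ h₂ N (pos_of_mem_starts hi))).symm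
  rw [e, add_div]
  congr 1
  simp only [Function.comp_apply]
  rcases Nat.eq_zero_or_pos ⌊γ * N⌋₊ with h3 | h3
  · rw [h3]
    simp [starts]
  · have : (⌊γ * N⌋₊ : ℝ) ≠ 0 := by exact_mod_cast h3.ne'
    field_simp

end Growth

/-! ### Almost sure convergence of the informations -/

open ProbabilityTheory in
/-- A strong law for monotone sequences whose variance grows at most linearly: along the squares
the normalized second moments are summable, and monotonicity fills the gaps. -/
theorem ae_tendsto_div_of_variance_le {S : Type*} [MeasurableSpace S] {P : Measure S}
    [IsProbabilityMeasure P] {X : ℕ → S → ℝ} {C D : ℝ} (hX : ∀ N, MemLp (X N) 2 P)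
    (hmono : ∀ᵐ ω ∂P, Monotone fun N => X N ω) (hvar : ∀ N : ℕ, Var[X N; P] ≤ C * N)
    (hE : Tendsto (fun N : ℕ => (∫ ω, X N ω ∂P) / (N : ℝ)) atTop (𝓝 D)) :
    ∀ᵐ ω ∂P, Tendsto (fun N : ℕ => X N ω / (N : ℝ)) atTop (𝓝 D) := by
  let c : ℕ → ℕ := fun k => (k + 1) ^ 2
  have hc : Tendsto c atTop atTop :=
    tendsto_atTop_mono (fun k => show k ≤ (k + 1) ^ 2 by nlinarith) tendsto_id
  have hc0 : ∀ k, (0 : ℝ) < c k := fun k => by simp only [c]; positivity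
  let Y : ℕ → S → ℝ := fun k ω => (X (c k) ω - ∫ ω', X (c k) ω' ∂P) / c k
  have hYm : ∀ k, MemLp (Y k) 2 P := fun k => by
    have h := ((hX (c k)).sub (memLp_const (∫ ω', X (c k) ω' ∂P))).mul_const ((c k : ℝ)⁻¹)
    exact h
  have hYint : ∀ k, ∫ ω, Y k ω ^ 2 ∂P ≤ C * (1 / ((k : ℝ) + 1) ^ 2) := by
    intro k
    have e : ∫ ω, Y k ω ^ 2 ∂P = Var[X (c k); P] / (c k : ℝ) ^ 2 := by
      rw [variance_eq_integral (hX _).aestronglyMeasurable.aemeasurable, ← integral_div]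
      simp only [Y, div_pow]
    rw [e, div_le_iff₀ (pow_pos (hc0 k) 2)]
    refine (hvar _).trans (le_of_eq ?_)
    simp only [c]
    push_cast
    field_simp
  have hsum : ∀ᵐ ω ∂P, ∑' k, ENNReal.ofReal (Y k ω ^ 2) < ⊤ := by
    refine ae_lt_top' ?_ ?_
    · exact AEMeasurable.tsum fun k =>
        ((hYm k).aestronglyMeasurable.aemeasurable.pow_const 2).ennreal_ofReal
    · rw [lintegral_tsum fun k =>
        ((hYm k).aestronglyMeasurable.aemeasurable.pow_const 2).ennreal_ofReal]
      have hs : Summable fun k : ℕ => C * (1 / ((k : ℝ) + 1) ^ 2) := by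
        have := (summable_nat_add_iff 1).2 (Real.summable_one_div_nat_pow.2 one_lt_two)
        exact (this.congr fun k => by push_cast; rfl).mul_left C
      refine ne_top_of_le_ne_top hs.tsum_ofReal_ne_top (ENNReal.tsum_le_tsum fun k => ?_)
      rw [← ofReal_integral_eq_lintegral_ofReal (hYm k).integrable_sq
        (ae_of_all _ fun ω => sq_nonneg _)]
      exact ENNReal.ofReal_le_ofReal (hYint k)
  filter_upwards [hsum, hmono] with ω hω hm
  refine tendsto_div_of_monotone_of_exists_subseq_tendsto_div _ D hm fun a ha =>
    ⟨c, ?_, hc, ?_⟩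
  · have h1 : Tendsto (fun n : ℕ => (1 + 1 / ((n : ℝ) + 1)) ^ 2) atTop (𝓝 1) := by
      simpa using (tendsto_one_div_add_atTop_nhds_zero_nat (𝕜 := ℝ)).const_add 1 |>.pow 2
    filter_upwards [h1.eventually_le_const ha] with n hn
    have h2 := mul_le_mul_of_nonneg_right hn (hc0 n).le
    refine le_trans (le_of_eq ?_) h2
    simp only [c]
    push_cast
    field_simp
  · have h0 : Tendsto (fun k => Y k ω) atTop (𝓝 0) := by
      have h1 := ENNReal.tendsto_atTop_zero_of_tsum_ne_top hω.ne
      have h2 := (ENNReal.tendsto_toReal ENNReal.zero_ne_top).comp h1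
      have h3 : Tendsto (fun k => Y k ω ^ 2) atTop (𝓝 0) := by
        refine h2.congr fun k => ?_
        simp only [Function.comp_apply]
        exact ENNReal.toReal_ofReal (sq_nonneg _)
      have h4 := h3.sqrt
      rw [Real.sqrt_zero] at h4
      simp only [Real.sqrt_sq_eq_abs] at h4
      exact (tendsto_zero_iff_abs_tendsto_zero _).2 h4
    have h5 := h0.add (hE.comp hc)
    rw [zero_add] at h5
    refine h5.congr fun k => ?_
    simp only [Y, Function.comp_apply]
    ring

section Information

variable {Ω : Set (Sym m₁ m₂)} (μ : Measure Ω) [IsProbabilityMeasure μ]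

theorem exists_sum_powCount_sq_le {q : ℕ} (hq : 2 ≤ q) :
    ∃ M : ℝ, ∀ N : ℕ, ∑ i ∈ starts q N, (powCount q N i : ℝ) ^ 2 ≤ M * N := by
  have h := tendsto_tsum_card_starts hq (g := fun l => 2 * (l : ℝ) + 1) (C := 2) fun l => by
    rw [abs_of_nonneg (by positivity)]
    nlinarith [sq_nonneg (l : ℝ), (Nat.cast_nonneg l : (0 : ℝ) ≤ l)]
  obtain ⟨M, hM⟩ := h.bddAbove_range
  refine ⟨M, fun N => ?_⟩
  have h1 : ∀ b : ℕ, ∑ l ∈ Finset.range b, (2 * (l : ℝ) + 1) = (b : ℝ) ^ 2 := by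
    intro b
    induction b with
    | zero => simp
    | succ b ih => rw [Finset.sum_range_succ, ih]; push_cast; ring
  have h2 := sum_range_powCount hq (le_refl N) (fun l => 2 * (l : ℝ) + 1)
  simp only [h1] at h2
  rcases Nat.eq_zero_or_pos N with rfl | hN
  · simp [starts]
  · rw [h2, ← div_le_iff₀ (by positivity)]
    exact hM ⟨N, rfl⟩

theorem memLp_info_eval (a b i : ℕ) :
    MemLp (fun ω : ℕ → Sym m₁ m₂ => info (μ.map Subtype.val) a b (ω i)) 2 (seqLaw μ) :=
  (memLp_info (μ.map Subtype.val) a b).comp_measurePreserving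
    (measurePreserving_eval_infinitePi (fun _ : ℕ => μ.map Subtype.val) i)

theorem integral_comp_eval {g : Sym m₁ m₂ → ℝ} (hg : Measurable g) (i : ℕ) :
    ∫ ω, g (ω i) ∂seqLaw μ = ∫ z, g z ∂(μ.map Subtype.val) := by
  have h := measurePreserving_eval_infinitePi (fun _ : ℕ => μ.map Subtype.val) i
  rw [← h.map_eq, integral_map h.measurable.aemeasurable hg.aestronglyMeasurable]
  rfl

open ProbabilityTheory in
theorem variance_sum_info_le {q : ℕ} (hq : 2 ≤ q) (hm₁ : 1 ≤ m₁) (hm₂ : 1 ≤ m₂) :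
    ∃ C : ℝ, ∀ n N : ℕ, n ≤ N → Var[fun ω => ∑ i ∈ starts q N, info (μ.map Subtype.val)
      (powCount q n i) (powCount q N i) (ω i); seqLaw μ] ≤ C * N := by
  obtain ⟨M, hM⟩ := exists_sum_powCount_sq_le hq
  set K := 2 * Real.log (m₁ * m₂ * m₂) ^ 2 with hK
  refine ⟨4 + K * M, fun n N hnN => ?_⟩
  have hind := iIndepFun_infinitePi (P := fun _ : ℕ => μ.map Subtype.val)
    (X := fun i => info (μ.map Subtype.val) (powCount q n i) (powCount q N i))
    (fun i => measurable_info _ _ _)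
  have h := IndepFun.variance_sum (μ := seqLaw μ) (s := starts q N)
    (X := fun i ω => info (μ.map Subtype.val) (powCount q n i) (powCount q N i) (ω i))
    (fun i _ => memLp_info_eval μ _ _ i) (fun i _ k _ hik => hind.indepFun hik)
  have e : (fun ω : ℕ → Sym m₁ m₂ => ∑ i ∈ starts q N, info (μ.map Subtype.val)
      (powCount q n i) (powCount q N i) (ω i)) = ∑ i ∈ starts q N, fun ω =>
        info (μ.map Subtype.val) (powCount q n i) (powCount q N i) (ω i) := by
    ext ω; rw [Finset.sum_apply]
  rw [e, h]
  calc ∑ i ∈ starts q N, Var[fun ω => info (μ.map Subtype.val) (powCount q n i)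
          (powCount q N i) (ω i); seqLaw μ]
      ≤ ∑ i ∈ starts q N, (4 + K * (powCount q N i : ℝ) ^ 2) := by
        refine Finset.sum_le_sum fun i hi => ?_
        refine (variance_le_expectation_sq
          (memLp_info_eval μ _ _ i).aestronglyMeasurable).trans ?_
        have h2 := integral_comp_eval μ
          ((measurable_info (μ.map Subtype.val) (powCount q n i) (powCount q N i)).pow_const 2) i
        refine (le_of_eq h2).trans ?_
        exact integral_info_sq_le hm₁ hm₂ _ (powCount_mono hq hnN (pos_of_mem_starts hi))
    _ = 4 * (starts q N).card + K * ∑ i ∈ starts q N, (powCount q N i : ℝ) ^ 2 := by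
        rw [Finset.sum_add_distrib, Finset.sum_const, nsmul_eq_mul, Finset.mul_sum]; ring
    _ ≤ 4 * N + K * (M * N) := by
        have h3 : ((starts q N).card : ℝ) ≤ N := by exact_mod_cast card_starts_le q N
        have h4 := mul_le_mul_of_nonneg_left (hM N) (show 0 ≤ K by positivity)
        linarith
    _ = (4 + K * M) * N := by ring

/-- Along the approximate squares of scale `N`, the measure `ℙ_μ` decays at the rate given by the
expected informations. -/
theorem ae_tendsto_info_PMeas {q : ℕ} (hq : 2 ≤ q) (hm₁ : 1 ≤ m₁) (hm₂ : 1 ≤ m₂) {γ D : ℝ}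
    (hγ : 0 ≤ γ) (hγ1 : γ ≤ 1)
    (hD : Tendsto (fun N : ℕ => (∑ i ∈ starts q N, squareEntropy (μ.map Subtype.val)
      (powCount q ⌊γ * N⌋₊ i) (powCount q N i)) / (N : ℝ)) atTop (𝓝 D)) :
    ∀ᵐ z ∂PMeas q μ, Tendsto (fun N : ℕ => info (PMeas q μ) ⌊γ * N⌋₊ N z / (N : ℝ)) atTop
      (𝓝 D) := by
  refine ae_PMeas_of_ae_seqLaw μ (measurableSet_tendsto _ fun N =>
    (measurable_info _ _ _).div_const _) ?_
  have hle : ∀ N : ℕ, ⌊γ * N⌋₊ ≤ N := fun N =>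
    Nat.floor_le_of_le (mul_le_of_le_one_left (Nat.cast_nonneg N) hγ1)
  have hpos : ∀ᵐ ω ∂seqLaw μ, ∀ a b, 0 < (PMeas q μ).real (approxSq a b (assemble q ω)) :=
    ae_of_ae_map (measurable_assemble q).aemeasurable (ae_approxSq_pos (PMeas q μ))
  have hlog := ae_neg_log_PMeas_approxSq μ hq
  let X : ℕ → (ℕ → Sym m₁ m₂) → ℝ := fun N ω => ∑ i ∈ starts q N, info (μ.map Subtype.val)
    (powCount q ⌊γ * N⌋₊ i) (powCount q N i) (ω i)
  obtain ⟨C, hC⟩ := variance_sum_info_le μ hq hm₁ hm₂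
  have hmono : ∀ᵐ ω ∂seqLaw μ, Monotone fun N => X N ω := by
    filter_upwards [hpos, hlog] with ω h1 h2 N N' hNN
    simp only [X]
    rw [← h2 _ _ (hle N), ← h2 _ _ (hle N')]
    refine neg_le_neg (Real.log_le_log (h1 _ _) (measureReal_mono (approxSq_subset ?_ hNN _)))
    exact Nat.floor_le_floor (mul_le_mul_of_nonneg_left (by exact_mod_cast hNN) hγ)
  have hE : ∀ N : ℕ, ∫ ω, X N ω ∂seqLaw μ = ∑ i ∈ starts q N,
      squareEntropy (μ.map Subtype.val) (powCount q ⌊γ * N⌋₊ i) (powCount q N i) := by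
    intro N
    rw [integral_finsetSum _ fun i _ => (memLp_info_eval μ _ _ i).integrable one_le_two]
    refine Finset.sum_congr rfl fun i _ => ?_
    rw [← integral_info]
    exact integral_comp_eval μ (measurable_info _ _ _) i
  have h := ae_tendsto_div_of_variance_le (X := X) (C := C) (D := D)
    (fun N => memLp_finsetSum _ fun i _ => memLp_info_eval μ _ _ i) hmono
    (fun N => hC _ N (hle N)) (by simpa only [hE] using hD)
  filter_upwards [h, hlog] with ω h1 h2
  refine h1.congr fun N => ?_
  rw [info, h2 _ _ (hle N)]

end Information

/-! ### Exact dimensionality -/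

/-- Balls are approximate squares up to a bounded change of scale, so the decay of approximate
squares along integer scales gives the local dimension. -/
theorem tendsto_log_closedBall_div_log (h₁ : 2 ≤ m₁) (h₂ : 2 ≤ m₂) (ν : Measure (Sym m₁ m₂))
    [IsProbabilityMeasure ν] {z : Sym m₁ m₂} (hpos : ∀ a b, 0 < ν.real (approxSq a b z)) {D : ℝ}
    (hD : Tendsto (fun N : ℕ => info ν ⌊gam m₁ m₂ * N⌋₊ N z / (N : ℝ)) atTop (𝓝 D)) :
    letI : MetricSpace (Sym m₁ m₂) := qsMetric h₁ h₂
    Tendsto (fun r : ℝ => Real.log (ν.real (Metric.closedBall z r)) / Real.log r)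
      (𝓝[>] 0) (𝓝 (D / Real.log m₂)) := by
  let : MetricSpace (Sym m₁ m₂) := qsMetric h₁ h₂
  have hl₁ : 0 < Real.log m₁ := Real.log_pos (by exact_mod_cast h₁)
  have hl₂ : 0 < Real.log m₂ := Real.log_pos (by exact_mod_cast h₂)
  set γ := gam m₁ m₂ with hγ
  have hγ0 : 0 < γ := div_pos hl₂ hl₁
  have hmono : ∀ {a a' b b' : ℕ}, a ≤ a' → b ≤ b' → info ν a b z ≤ info ν a' b' z :=
    fun ha hb => neg_le_neg
      (Real.log_le_log (hpos _ _) (measureReal_mono (approxSq_subset ha hb z)))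
  -- The ball at scale `t` lies between the approximate squares of scales `⌊t⌋` and `⌈t + 1 / γ⌉`;
  -- the shift by `1 / γ` absorbs the rounding up of `γ t`.
  have hlow : Tendsto (fun t : ℝ => info ν ⌊γ * ⌊t⌋₊⌋₊ ⌊t⌋₊ z / t) atTop (𝓝 D) := by
    have h := (hD.comp (tendsto_nat_floor_atTop (α := ℝ))).mul
      (tendsto_nat_floor_div_atTop (R := ℝ))
    rw [mul_one] at h
    refine h.congr' ?_
    filter_upwards [eventually_ge_atTop 1] with t ht
    have : (⌊t⌋₊ : ℝ) ≠ 0 := by exact_mod_cast (Nat.floor_pos.2 ht).ne'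
    simp only [Function.comp_apply]
    field_simp
  have hupp : Tendsto (fun t : ℝ => info ν ⌊γ * ⌈t + 1 / γ⌉₊⌋₊ ⌈t + 1 / γ⌉₊ z / t) atTop
      (𝓝 D) := by
    have hs : Tendsto (fun t : ℝ => t + 1 / γ) atTop atTop :=
      tendsto_atTop_add_const_right _ _ tendsto_id
    have hr : Tendsto (fun t : ℝ => (t + 1 / γ) / t) atTop (𝓝 1) := by
      have h1 := (tendsto_inv_atTop_zero (𝕜 := ℝ)).const_mul (1 / γ) |>.const_add 1
      rw [mul_zero, add_zero] at h1
      refine h1.congr' ?_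
      filter_upwards [eventually_gt_atTop 0] with t ht
      field_simp
    have h := ((hD.comp ((tendsto_nat_ceil_atTop (α := ℝ)).comp hs)).mul
      ((tendsto_nat_ceil_div_atTop (R := ℝ)).comp hs)).mul hr
    rw [mul_one, mul_one] at h
    refine h.congr' ?_
    filter_upwards [eventually_gt_atTop 0] with t ht
    have h0 : 0 < t + 1 / γ := by positivity
    have : (⌈t + 1 / γ⌉₊ : ℝ) ≠ 0 := by exact_mod_cast (Nat.ceil_pos.2 h0).ne'
    simp only [Function.comp_apply]
    generalize t + 1 / γ = s at *
    field_simp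
  have hV : Tendsto (fun t : ℝ => info ν ⌈γ * t⌉₊ ⌈t⌉₊ z / t) atTop (𝓝 D) := by
    refine tendsto_of_tendsto_of_tendsto_of_le_of_le' hlow hupp ?_ ?_
    · filter_upwards [eventually_gt_atTop 0] with t ht
      refine div_le_div_of_nonneg_right (hmono ?_ (Nat.floor_le_ceil t)) ht.le
      refine (Nat.floor_le_floor ?_).trans (Nat.floor_le_ceil _)
      exact mul_le_mul_of_nonneg_left (Nat.floor_le ht.le) hγ0.le
    · filter_upwards [eventually_gt_atTop 0] with t ht
      refine div_le_div_of_nonneg_right (hmono ?_ (Nat.ceil_mono ?_)) ht.le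
      · refine Nat.le_floor ((Nat.ceil_lt_add_one (by positivity)).le.trans ?_)
        calc γ * t + 1 = γ * (t + 1 / γ) := by field_simp
          _ ≤ _ := mul_le_mul_of_nonneg_left (Nat.le_ceil _) hγ0.le
      · have : 0 < 1 / γ := by positivity
        linarith
  have ht : Tendsto (fun r : ℝ => -Real.log r / Real.log m₂) (𝓝[>] 0) atTop :=
    (tendsto_neg_atBot_atTop.comp Real.tendsto_log_nhdsGT_zero).atTop_div_const hl₂
  refine ((hV.comp ht).div_const (Real.log m₂)).congr' ?_
  filter_upwards [Ioo_mem_nhdsGT one_pos] with r hr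
  have hlr : Real.log r ≠ 0 := (Real.log_neg hr.1 hr.2).ne
  rw [closedBall_eq_approxSq h₁ h₂ z hr.1]
  simp only [Function.comp_apply]
  have e : γ * (-Real.log r / Real.log m₂) = -Real.log r / Real.log m₁ := by
    rw [hγ, gam]; field_simp
  rw [e, info]
  field_simp

theorem exists_squareEntropy_le (hm₁ : 1 ≤ m₁) (hm₂ : 1 ≤ m₂) (ν : Measure (Sym m₁ m₂))
    [IsProbabilityMeasure ν] :
    ∃ C : ℝ, ∀ a b, a ≤ b → |squareEntropy ν a b| ≤ C * ((b : ℝ) + 1) ^ 2 := by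
  refine ⟨5 + 2 * Real.log (m₁ * m₂ * m₂) ^ 2, fun a b hab => ?_⟩
  rw [abs_of_nonneg (squareEntropy_nonneg ν a b)]
  refine (squareEntropy_le hm₁ hm₂ ν hab).trans ?_
  have hK : 0 ≤ 2 * Real.log (m₁ * m₂ * m₂) ^ 2 := by positivity
  have hb : (0 : ℝ) ≤ b := Nat.cast_nonneg b
  nlinarith [mul_nonneg hK hb]

variable {Ω : Set (Sym m₁ m₂)} (μ : Measure Ω)

theorem termA_eq (q j k : ℕ) : termA q j μ k =
    squareEntropy (μ.map Subtype.val) (k + 1) (j + 1 + k) / (q : ℝ) ^ (j + 1 + k + 1) /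
      Real.log m₂ := by
  rw [termA, entropy_joinPart, div_right_comm]

theorem termB_eq (q j k : ℕ) : termB q j μ k =
    squareEntropy (μ.map Subtype.val) k (j + 1 + k) / (q : ℝ) ^ (j + 1 + k) / Real.log m₂ := by
  rw [termB, entropy_joinPart, div_right_comm]

theorem dimValue_eq (q j : ℕ) : dimValue q j μ =
    (((q : ℝ) - 1) ^ 2 *
        ∑ p ∈ Finset.Icc 1 j, squareEntropy (μ.map Subtype.val) 0 p / (q : ℝ) ^ (p + 1)
      + ((q : ℝ) - 1) * ((q : ℝ) ^ (j + 1) * gam m₁ m₂ - 1) *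
        ∑' k, squareEntropy (μ.map Subtype.val) (k + 1) (j + 1 + k) / (q : ℝ) ^ (j + 1 + k + 1)
      + ((q : ℝ) - 1) * (1 - (q : ℝ) ^ j * gam m₁ m₂) *
        ∑' k, squareEntropy (μ.map Subtype.val) k (j + 1 + k) / (q : ℝ) ^ (j + 1 + k)) /
      Real.log m₂ := by
  simp only [dimValue, termA_eq, termB_eq, tsum_div_const, entropy_alpha1]
  simp only [div_right_comm _ (Real.log m₂), ← Finset.sum_div]
  ring

end MultCarpet

theorem theorem2p2 (m₁ m₂ q j : ℕ) (hm₂ : 2 ≤ m₂) (hm : m₂ < m₁) (hq : 2 ≤ q)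
    (hj : (q : ℝ) ^ j ≤ Real.log m₁ / Real.log m₂)
    (hj' : Real.log m₁ / Real.log m₂ < (q : ℝ) ^ (j + 1))
    (Ω : Set (Sym m₁ m₂)) (hΩ : IsClosed Ω) (μ : Measure Ω) [IsProbabilityMeasure μ] :
    letI : MetricSpace (Sym m₁ m₂) := qsMetric (hm₂.trans hm.le) hm₂
    PMeas q μ (XSet q Ω)ᶜ = 0 ∧
      Summable (termA q j μ) ∧ Summable (termB q j μ) ∧
      HasExactDim (PMeas q μ) (dimValue q j μ) ∧
      lowerDimH (PMeas q μ) = ENNReal.ofReal (dimValue q j μ) ∧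
      upperDimH (PMeas q μ) = ENNReal.ofReal (dimValue q j μ) := by
  have hl₁ : 0 < Real.log m₁ := Real.log_pos (by exact_mod_cast (by omega : 1 < m₁))
  have hl₂ : 0 < Real.log m₂ := Real.log_pos (by exact_mod_cast hm₂)
  have hγ0 : 0 ≤ gam m₁ m₂ := (div_pos hl₂ hl₁).le
  have hγ1 : gam m₁ m₂ ≤ 1 := by
    rw [gam, div_le_one hl₁]
    exact Real.log_le_log (by exact_mod_cast (by omega : 0 < m₂)) (by exact_mod_cast hm.le)
  have hc₁ : (q : ℝ) ^ j * gam m₁ m₂ ≤ 1 := by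
    rw [gam, ← mul_div_assoc, div_le_one hl₁]
    exact (le_div_iff₀ hl₂).1 hj
  have hc₂ : 1 ≤ (q : ℝ) ^ (j + 1) * gam m₁ m₂ := by
    rw [gam, ← mul_div_assoc, one_le_div hl₁]
    exact ((div_lt_iff₀ hl₂).1 hj').le
  have h₁ : 1 ≤ m₁ := by omega
  have h₂ : 1 ≤ m₂ := by omega
  obtain ⟨C, hC⟩ := exists_squareEntropy_le h₁ h₂ (μ.map Subtype.val)
  let : MetricSpace (Sym m₁ m₂) := qsMetric (hm₂.trans hm.le) hm₂
  have hlim := tendsto_sum_starts hC hq (squareEntropy_zero _) hγ0 hγ1 hc₁ hc₂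
  rw [tsum_steps hC hq (squareEntropy_zero _)] at hlim
  have hdim : HasExactDim (PMeas q μ) (dimValue q j μ) := by
    filter_upwards [ae_tendsto_info_PMeas μ hq h₁ h₂ hγ0 hγ1 hlim,
      ae_approxSq_pos (PMeas q μ)] with z hz hpos
    rw [dimValue_eq]
    exact tendsto_log_closedBall_div_log (hm₂.trans hm.le) hm₂ (PMeas q μ) hpos hz
  -- The topology of the quasi-square metric is the product topology by definition.
  have hB : BorelSpace (Sym m₁ m₂) := inferInstanceAs (BorelSpace (ℕ → Fin m₁ × Fin m₂))
  have hS : SecondCountableTopology (Sym m₁ m₂) :=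
    inferInstanceAs (SecondCountableTopology (ℕ → Fin m₁ × Fin m₂))
  have hge := hdim.lowerDimH_ge
  have hle := hdim.upperDimH_le
  have hlu := lowerDimH_le_upperDimH (PMeas q μ)
  refine ⟨PMeas_compl_XSet μ hq hΩ, ?_, ?_, hdim, (hlu.trans hle).antisymm hge,
    hle.antisymm (hge.trans hlu)⟩
  · exact ((summable_termX hC hq j).div_const _).congr fun k => (termA_eq μ q j k).symm
  · exact ((summable_termY hC hq j).div_const _).congr fun k => (termB_eq μ q j k).symm
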